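/- A tropical curve $\Gamma$ is the topological space obtained from a finite connected nonempty multigraph $G$ (loops allowed) with a length function $l : E(G) \to \mathbb{R}_{>0} \cup \{\infty\}$, where $l$ takes the value $\infty$ on leaf edges only, by identifying each edge $e$ with the interval $[0, l(e)]$; if $l(e) = \infty$, then $\infty \in [0,\infty]$ is a leaf end of $e$, called a point at infinity. Then $(G,l)$ is called a model of $\Gamma$ (a tropical curve has many models), and $\operatorname{dist}$ is the path distance on $\Gamma$; the distance between a point at infinity and any other point is $\infty$. A continuous map $f : \Gamma \to \mathbb{R} \cup \{\pm\infty\}$ is a rational function on $\Gamma$ if it is the constant function $-\infty$, or if it is piecewise affine with integer slopes and finitely many pieces and takes the values $\pm\infty$ at points at infinity only. The set $\operatorname{Rat}(\Gamma)$ of rational functions is a semiring with the sum $\max\{f, g\}$ and the product $f + g$ (computed at the points not at infinity and extended continuously), and it is an algebra over the tropical semifield $\mathbf{T} = (\mathbb{R} \cup \{-\infty\}, \max, +)$ through the constant functions. A continuous map $\varphi : \Gamma \to \Gamma'$ of tropical curves is a finite harmonic morphism if there are loopless models $(G,l)$ of $\Gamma$ and $(G',l')$ of $\Gamma'$ such that: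 $\varphi(V(G)) \subset V(G')$; $\varphi(E(G)) \subset E(G')$; for each edge $e$ of $G$ there is a positive integer $\deg_e(\varphi)$ with $\operatorname{dist}(\varphi(x), \varphi(y)) = \deg_e(\varphi) \operatorname{dist}(x,y)$ for all $x, y \in e$; and for each vertex $v$ of $G$ the sum $\deg_v(\varphi) = \sum_{e \ni v,\, e \mapsto e'} \deg_e(\varphi)$ is the same for all edges $e'$ of $G'$ incident to $\varphi(v)$. Its degree is $\sum_{v \mapsto v'} \deg_v(\varphi)$ for any vertex $v'$ of $G'$ (this does not depend on $v'$). If $\Gamma$ and $\Gamma'$ are both singletons, $\varphi$ is regarded as a finite harmonic morphism that can have any positive integer as its degree. An automorphism of $\Gamma$ is a finite harmonic morphism $\Gamma \to \Gamma$ of degree one. **Corollary.** Let $\Gamma$ be a tropical curve. The automorphisms of $\Gamma$ are bijective and form a group $\operatorname{Aut}(\Gamma)$ under composition, and this group is isomorphic to the group $\operatorname{Aut}_{\mathbf{T}}(\operatorname{Rat}(\Gamma))$ of $\mathbf{T}$-algebra automorphisms of $\operatorname{Rat}(\Gamma)$. -/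

import Mathlib

open Set Filter Topology
open scoped ENNReal NNReal

noncomputable section

/-! ### The tropical semifield -/

/-- The tropical semifield: `ℝ ∪ {-∞}` with maximum as addition and the usual sum as
multiplication (`⊥` is `-∞`). -/
def TropicalSemifield : Type := WithBot ℝ

namespace TropicalSemifield

instance : Add TropicalSemifield := ⟨fun a b => max (α := WithBot ℝ) a b⟩

instance : Zero TropicalSemifield := ⟨(⊥ : WithBot ℝ)⟩

instance : Mul TropicalSemifield := ⟨Add.add (α := WithBot ℝ)⟩

instance : One TropicalSemifield := ⟨((0 : ℝ) : WithBot ℝ)⟩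

instance : CommSemiring TropicalSemifield where
  add_assoc a b c := max_assoc (α := WithBot ℝ) a b c
  zero_add a := max_eq_right (α := WithBot ℝ) bot_le
  add_zero a := max_eq_left (α := WithBot ℝ) bot_le
  add_comm a b := max_comm (α := WithBot ℝ) a b
  mul_assoc a b c := add_assoc (G := WithBot ℝ) a b c
  one_mul a := zero_add (M := WithBot ℝ) a
  mul_one a := add_zero (M := WithBot ℝ) a
  mul_comm a b := add_comm (G := WithBot ℝ) a b
  zero_mul a := WithBot.bot_add a
  mul_zero a := WithBot.add_bot a
  left_distrib a b c :=
    (max_add_add_left (α := WithBot ℝ) a b c).symm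
  right_distrib a b c :=
    (max_add_add_right (α := WithBot ℝ) a b c).symm
  nsmul := nsmulRec

/-- The inclusion of `ℝ ∪ {-∞}` into `ℝ ∪ {±∞}`. -/
def toEReal : TropicalSemifield → EReal :=
  WithBot.recBotCoe (C := fun _ => EReal) ⊥ (fun r : ℝ => (r : EReal))

theorem toEReal_zero : toEReal 0 = ⊥ := rfl

theorem toEReal_one : toEReal 1 = 0 := rfl

theorem toEReal_add (a b : TropicalSemifield) :
    toEReal (a + b) = max (toEReal a) (toEReal b) := by
  induction a using WithBot.recBotCoe with
  | bot => exact (congrArg toEReal (zero_add b)).trans (max_eq_right bot_le).symm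
  | coe a =>
    induction b using WithBot.recBotCoe with
    | bot =>
      exact (congrArg toEReal (add_zero (M := TropicalSemifield) _)).trans
        (max_eq_left bot_le).symm
    | coe b =>
      change toEReal (max (α := WithBot ℝ) a b) = max (a : EReal) (b : EReal)
      rw [← WithBot.coe_max]
      exact EReal.coe_strictMono.monotone.map_max

theorem toEReal_mul (a b : TropicalSemifield) : toEReal (a * b) = toEReal a + toEReal b := by
  induction a using WithBot.recBotCoe with
  | bot => exact (congrArg toEReal (zero_mul b)).trans (EReal.bot_add _).symm
  | coe a =>
    induction b using WithBot.recBotCoe with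
    | bot =>
      exact (congrArg toEReal (mul_zero (M₀ := TropicalSemifield) _)).trans
        (EReal.add_bot _).symm
    | coe b => rfl

end TropicalSemifield

/-! ### Edge-weighted graphs -/

/-- A finite multigraph, possibly with loops. Every edge carries an orientation, which only
serves to say which end of the edge is the point `0` of the interval it is identified with. -/
structure Multigraph where
  /-- the vertices -/
  V : Type
  /-- the edges -/
  E : Type
  [fintypeV : Fintype V]
  [fintypeE : Fintype E]
  /-- the end of an edge that is identified with `0` -/
  src : E → V
  /-- the other end of an edge -/
  tgt : E → V

attribute [instance] Multigraph.fintypeV Multigraph.fintypeE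

namespace Multigraph

variable (G : Multigraph)

open Classical in
/-- The valence of a vertex; each loop is counted twice. -/
def valence (v : G.V) : ℕ :=
  (Finset.univ.filter fun e => G.src e = v).card + (Finset.univ.filter fun e => G.tgt e = v).card

/-- The graph is connected and nonempty. -/
def Connected : Prop :=
  Nonempty G.V ∧ ∀ u v : G.V,
    Relation.ReflTransGen
      (fun a b => ∃ e, (G.src e = a ∧ G.tgt e = b) ∨ (G.src e = b ∧ G.tgt e = a)) u v

/-- The edge `e` is incident to the vertex `v`. -/
def Incident (e : G.E) (v : G.V) : Prop := G.src e = v ∨ G.tgt e = v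

/-- The graph has no loops. -/
def Loopless : Prop := ∀ e, G.src e ≠ G.tgt e

end Multigraph

/-- A connected nonempty finite multigraph with lengths in `(0, ∞]` on the edges. The length `∞` is
allowed on leaf edges only, and then the end identified with `∞` has to be a leaf end. -/
structure EdgeWeightedGraph extends Multigraph where
  connected : toMultigraph.Connected
  /-- the length of an edge -/
  len : E → ℝ≥0∞
  len_pos : ∀ e, 0 < len e
  leaf_of_len_eq_top : ∀ e, len e = ⊤ → toMultigraph.valence (tgt e) = 1

/-! ### Tropical curves -/

/-- The structure of a tropical curve on a Hausdorff space `X`: an edge-weighted graph with an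
identification of `X` with the union of its vertices and of the closed intervals
`[0, len e] ⊆ [0, ∞]`, one for each edge `e`, glued at their ends as the graph prescribes.
The map `edge e` matters only on `[0, len e]`. The intervals are compact and `X` is Hausdorff, so
`X` carries the quotient topology. -/
structure TropicalCurve (X : Type*) [TopologicalSpace X] extends EdgeWeightedGraph where
  /-- the point of `X` given by a vertex -/
  point : V → X
  /-- the parametrization of an edge by `[0, len e]` -/
  edge : E → ℝ≥0∞ → X
  continuousOn_edge : ∀ e, ContinuousOn (edge e) (Iic (len e))
  edge_zero : ∀ e, edge e 0 = point (src e)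
  edge_len : ∀ e, edge e (len e) = point (tgt e)
  point_injective : Function.Injective point
  edge_ne_point : ∀ e, ∀ s ∈ Ioo 0 (len e), ∀ v, edge e s ≠ point v
  edge_injective : ∀ e e' s s', s ∈ Ioo 0 (len e) → s' ∈ Ioo 0 (len e') →
    edge e s = edge e' s' → e = e' ∧ s = s'
  cover : ∀ x, (∃ v, x = point v) ∨ ∃ e, ∃ s ∈ Ioo 0 (len e), x = edge e s

namespace TropicalCurve

variable {X : Type*} [TopologicalSpace X] {Y : Type*} [TopologicalSpace Y] (Γ : TropicalCurve X)

/-- The closed subset of the curve given by an edge. -/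
def edgeSet (e : Γ.E) : Set X := Γ.edge e '' Iic (Γ.len e)

/-- The set of points at infinity. -/
def infinitePoints : Set X := {x | ∃ e, Γ.len e = ⊤ ∧ x = Γ.edge e ⊤}

/-- The set of finite points. -/
def finitePoints : Set X := Γ.infinitePointsᶜ

/-- `Γ.IsPath x y d`: there is a path of length `d` from `x` to `y` that is composed of
finitely many segments of edges. In `[0, ∞]`, where subtraction is truncated, the segment between
the parameters `s` and `t` has length `(s - t) + (t - s)`, i.e. `|s - t|`, which is
`∞` if exactly one of them is `∞`, and is `0` if `s = t`. -/
inductive IsPath : X → X → ℝ≥0∞ → Prop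
  | refl (x : X) : IsPath x x 0
  | step (x : X) (d : ℝ≥0∞) (e : Γ.E) (s t : ℝ≥0∞) (hs : s ≤ Γ.len e) (ht : t ≤ Γ.len e)
      (h : IsPath x (Γ.edge e s) d) : IsPath x (Γ.edge e t) (d + ((s - t) + (t - s)))

/-- The distance between two points: the infimum of the lengths of the paths between them. The
distance between a point at infinity and any other point is `∞`. -/
def dist (x y : X) : ℝ≥0∞ := sInf {d | Γ.IsPath x y d}

/-- `M` is a model of the tropical curve `Γ`: both describe the same tropical curve, i.e. the same
space with the same distances. -/
def IsModelOf (M Γ : TropicalCurve X) : Prop := ∀ x y, M.dist x y = Γ.dist x y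

/-! ### Finite harmonic morphisms -/

open Classical in
/-- `φ` is harmonic for the loopless models `M` and `M'`, with degree `degE e` on the edge `e` and
degree `degV v` at the vertex `v`. -/
structure IsHarmonicFor (M : TropicalCurve X) (M' : TropicalCurve Y) (φ : X → Y)
    (degE : M.E → ℕ) (degV : M.V → ℕ) : Prop where
  loopless : M.Loopless
  loopless' : M'.Loopless
  map_vertex : ∀ v, ∃ v', φ (M.point v) = M'.point v'
  map_edge : ∀ e, ∃ e', φ '' M.edgeSet e = M'.edgeSet e'
  deg_pos : ∀ e, 0 < degE e
  dist_map : ∀ e, ∀ x ∈ M.edgeSet e, ∀ y ∈ M.edgeSet e,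
    M'.dist (φ x) (φ y) = degE e * M.dist x y
  balanced : ∀ v v' e', φ (M.point v) = M'.point v' → M'.Incident e' v' →
    ∑ e with M.Incident e v ∧ φ '' M.edgeSet e = M'.edgeSet e', degE e = degV v

open Classical in
/-- `φ` is a finite harmonic morphism of degree `d` between tropical curves. If both curves
are singletons, then every positive integer is a degree of `φ`. -/
def IsFiniteHarmonicOfDegree (Γ : TropicalCurve X) (Γ' : TropicalCurve Y) (φ : X → Y) (d : ℕ) :
    Prop :=
  Continuous φ ∧
    ((Subsingleton X ∧ Subsingleton Y ∧ 0 < d) ∨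
      (¬ (Subsingleton X ∧ Subsingleton Y) ∧
        ∃ (M : TropicalCurve X) (M' : TropicalCurve Y) (degE : M.E → ℕ) (degV : M.V → ℕ),
          M.IsModelOf Γ ∧ M'.IsModelOf Γ' ∧ IsHarmonicFor M M' φ degE degV ∧
          ∀ v', ∑ v with φ (M.point v) = M'.point v', degV v = d))

/-- An automorphism of a tropical curve is a finite harmonic morphism of degree one from the
curve to itself. -/
def IsAutomorphism (φ : X → X) : Prop := IsFiniteHarmonicOfDegree Γ Γ φ 1

/-! ### Points at infinity, helper facts -/

theorem eq_of_edge_eq_top {e e' : Γ.E} {s : ℝ≥0∞} (he : Γ.len e = ⊤) (hs : s ≤ Γ.len e')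
    (h : Γ.edge e' s = Γ.edge e ⊤) : e' = e ∧ s = ⊤ := by
  classical
  have hv := Γ.leaf_of_len_eq_top e he
  have htop : Γ.edge e ⊤ = Γ.point (Γ.tgt e) := by rw [← Γ.edge_len e, he]
  unfold Multigraph.valence at hv
  have hmem : e ∈ Finset.univ.filter fun f => Γ.tgt f = Γ.tgt e := by simp
  have h1 : 0 < (Finset.univ.filter fun f => Γ.tgt f = Γ.tgt e).card :=
    Finset.card_pos.2 ⟨e, hmem⟩
  rw [htop] at h
  rcases eq_or_lt_of_le hs with rfl | hlt
  · rw [Γ.edge_len] at h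
    have ht := Γ.point_injective h
    have hmem' : e' ∈ Finset.univ.filter fun f => Γ.tgt f = Γ.tgt e := by simp [ht]
    have : e' = e := Finset.card_le_one.1 (by omega) _ hmem' _ hmem
    exact ⟨this, by rw [this, he]⟩
  · rcases eq_or_ne s 0 with rfl | h0
    · rw [Γ.edge_zero] at h
      have ht := Γ.point_injective h
      have : 0 < (Finset.univ.filter fun f => Γ.src f = Γ.tgt e).card :=
        Finset.card_pos.2 ⟨e', by simp [ht]⟩
      omega
    · exact absurd h (Γ.edge_ne_point e' s ⟨pos_iff_ne_zero.2 h0, hlt⟩ _)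

theorem edge_coe_mem_finitePoints (e : Γ.E) (t : ℝ≥0) (ht : (t : ℝ≥0∞) ≤ Γ.len e) :
    Γ.edge e t ∈ Γ.finitePoints := by
  rintro ⟨e', he', h⟩
  exact ENNReal.coe_ne_top (Γ.eq_of_edge_eq_top he' ht h).2

/-- Near a point at infinity, the finite points are those far out on its leaf edge. -/
theorem nhdsWithin_top_le [T2Space X] {e : Γ.E} (he : Γ.len e = ⊤) :
    𝓝[Γ.finitePoints] (Γ.edge e ⊤) ≤ map (fun t : ℝ≥0 => Γ.edge e t) atTop := by
  classical
  intro U hU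
  rw [mem_map, mem_atTop_sets] at hU
  obtain ⟨T, hT⟩ := hU
  have htop : Γ.edge e ⊤ = Γ.point (Γ.tgt e) := by rw [← Γ.edge_len e, he]
  set K : Set X := (⋃ e' ∈ {e' : Γ.E | e' ≠ e}, Γ.edgeSet e') ∪ Γ.edge e '' Iic (T : ℝ≥0∞) ∪
    Γ.point '' {v | v ≠ Γ.tgt e} with hK
  have hclosed : IsClosed K := by
    refine IsClosed.union (IsClosed.union ?_ ?_) (Set.toFinite _).isClosed
    · refine (Set.toFinite _).isClosed_biUnion fun e' _ => ?_
      exact ((isClosed_Iic.isCompact).image_of_continuousOn (Γ.continuousOn_edge e')).isClosed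
    · refine ((isClosed_Iic.isCompact).image_of_continuousOn
        ((Γ.continuousOn_edge e).mono ?_)).isClosed
      intro s _
      rw [he]
      exact mem_Iic.2 le_top
  have hnot : Γ.edge e ⊤ ∉ K := by
    rintro ((h | h) | h)
    · simp only [mem_iUnion] at h
      obtain ⟨e', hne, s, hs, h⟩ := h
      exact hne (Γ.eq_of_edge_eq_top he hs h).1
    · obtain ⟨s, hs, h⟩ := h
      have := (Γ.eq_of_edge_eq_top he (by rw [he]; exact le_top) h).2
      rw [this] at hs
      exact ENNReal.coe_ne_top (top_le_iff.1 hs)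
    · obtain ⟨v, hv, h⟩ := h
      rw [htop] at h
      exact hv (Γ.point_injective h)
  refine mem_nhdsWithin.2 ⟨Kᶜ, hclosed.isOpen_compl, hnot, ?_⟩
  rintro z ⟨hzK, hzA⟩
  rcases Γ.cover z with ⟨v, rfl⟩ | ⟨e', s, hs, rfl⟩
  · by_cases hv : v = Γ.tgt e
    · subst hv
      exact absurd ⟨e, he, htop.symm⟩ hzA
    · exact absurd (Or.inr ⟨v, hv, rfl⟩) hzK
  · have hee : e' = e := by
      by_contra hne
      exact hzK (Or.inl (Or.inl (mem_biUnion hne ⟨s, hs.2.le, rfl⟩)))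
    subst hee
    have hTs : (T : ℝ≥0∞) < s := by
      by_contra hle
      exact hzK (Or.inl (Or.inr ⟨s, not_lt.1 hle, rfl⟩))
    have hsne : s ≠ ⊤ := (hs.2.trans_le le_top).ne
    lift s to ℝ≥0 using hsne
    exact hT s (by exact_mod_cast hTs.le)

theorem dense_finitePoints : Dense Γ.finitePoints := by
  intro x
  by_cases hx : x ∈ Γ.finitePoints
  · exact subset_closure hx
  · obtain ⟨e, he, rfl⟩ : x ∈ Γ.infinitePoints := not_not.1 hx
    have hc : ContinuousAt (Γ.edge e) ⊤ := by
      have := Γ.continuousOn_edge e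
      rw [he, Iic_top, continuousOn_univ] at this
      exact this.continuousAt
    have ht : Tendsto (fun t : ℝ≥0 => Γ.edge e t) atTop (𝓝 (Γ.edge e ⊤)) :=
      hc.tendsto.comp (ENNReal.tendsto_coe_nhds_top.2 tendsto_id)
    exact mem_closure_of_tendsto ht (Eventually.of_forall fun t =>
      Γ.edge_coe_mem_finitePoints e t (by rw [he]; exact le_top))

/-! ### Rational functions -/

/-- `f` is piecewise affine with integer slopes and with a finite number of pieces: on each edge
there is a finite set `S` of parameters such that `f` is affine with an integer slope on every
interval of finite parameters that avoids `S`. -/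
def IsPiecewiseAffine (f : X → EReal) : Prop :=
  ∀ e : Γ.E, ∃ S : Finset ℝ≥0, ∀ I : Set ℝ≥0, I.OrdConnected → (∀ t ∈ I, (t : ℝ≥0∞) ≤ Γ.len e) →
    (∀ t ∈ I, t ∉ S) →
      ∃ (n : ℤ) (c : ℝ), ∀ t ∈ I, f (Γ.edge e t) = ((n * (t : ℝ) + c : ℝ) : EReal)

/-- A rational function: a continuous map to `ℝ ∪ {±∞}` that is the constant function `-∞`, or is
piecewise affine with integer slopes and finitely many pieces and takes the values
`±∞` at points at infinity only. -/
structure IsRational (f : X → EReal) : Prop where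
  continuous : Continuous f
  eq_bot_or : (∀ x, f x = ⊥) ∨
    (Γ.IsPiecewiseAffine f ∧ ∀ x ∈ Γ.finitePoints, f x ≠ ⊥ ∧ f x ≠ ⊤)

/-- The set `Rat(Γ)` of rational functions. -/
def RatFun : Type _ := {f : X → EReal // Γ.IsRational f}

variable {Γ}

theorem IsPiecewiseAffine.add {f g h : X → EReal} (hf : Γ.IsPiecewiseAffine f)
    (hg : Γ.IsPiecewiseAffine g) (hh : ∀ x ∈ Γ.finitePoints, h x = f x + g x) :
    Γ.IsPiecewiseAffine h := by
  classical
  intro e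
  obtain ⟨S, hS⟩ := hf e
  obtain ⟨S', hS'⟩ := hg e
  refine ⟨S ∪ S', fun I hI hIe hIS => ?_⟩
  obtain ⟨n, c, h1⟩ := hS I hI hIe fun t ht hts => hIS t ht (Finset.mem_union_left _ hts)
  obtain ⟨m, d, h2⟩ := hS' I hI hIe fun t ht hts => hIS t ht (Finset.mem_union_right _ hts)
  refine ⟨n + m, c + d, fun t ht => ?_⟩
  rw [hh _ (Γ.edge_coe_mem_finitePoints e t (hIe t ht)), h1 t ht, h2 t ht, ← EReal.coe_add]
  congr 1
  push_cast
  ring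

theorem IsPiecewiseAffine.max {f g : X → EReal} (hf : Γ.IsPiecewiseAffine f)
    (hg : Γ.IsPiecewiseAffine g) : Γ.IsPiecewiseAffine fun x => max (f x) (g x) := by
  classical
  intro e
  obtain ⟨S₁, hS₁⟩ := hf e
  obtain ⟨S₂, hS₂⟩ := hg e
  set S := S₁ ∪ S₂ with hS
  -- the piece of the finite parameters above exactly the members of `U`
  let P : Finset ℝ≥0 → Set ℝ≥0 := fun U =>
    {t | (t : ℝ≥0∞) ≤ Γ.len e ∧ t ∉ S ∧ S.filter (· < t) = U}
  have hP : ∀ U, (P U).OrdConnected := by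
    intro U
    refine ⟨fun a ha b hb t ht => ?_⟩
    have hsub : S.filter (· < t) = U := by
      refine Finset.Subset.antisymm ?_ ?_
      · rw [← hb.2.2]
        exact fun s hs => by
          simp only [Finset.mem_filter] at hs ⊢
          exact ⟨hs.1, hs.2.trans_le ht.2⟩
      · rw [← ha.2.2]
        exact fun s hs => by
          simp only [Finset.mem_filter] at hs ⊢
          exact ⟨hs.1, hs.2.trans_le ht.1⟩
    refine ⟨le_trans (by exact_mod_cast ht.2) hb.1, fun htS => ?_, hsub⟩
    rcases eq_or_lt_of_le ht.2 with h | h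
    · exact hb.2.1 (h ▸ htS)
    · have : t ∈ S.filter (· < t) := by
        rw [hsub, ← hb.2.2]
        exact Finset.mem_filter.2 ⟨htS, h⟩
      exact lt_irrefl _ (Finset.mem_filter.1 this).2
  have hf' : ∀ U, ∃ (n : ℤ) (c : ℝ), ∀ t ∈ P U, f (Γ.edge e t) = ((n * (t : ℝ) + c : ℝ) : EReal) :=
    fun U => hS₁ (P U) (hP U) (fun t ht => ht.1)
      fun t ht hts => ht.2.1 (Finset.mem_union_left _ hts)
  have hg' : ∀ U, ∃ (n : ℤ) (c : ℝ), ∀ t ∈ P U, g (Γ.edge e t) = ((n * (t : ℝ) + c : ℝ) : EReal) :=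
    fun U => hS₂ (P U) (hP U) (fun t ht => ht.1)
      fun t ht hts => ht.2.1 (Finset.mem_union_right _ hts)
  choose n c hnc using hf'
  choose m d hmd using hg'
  -- the point of the piece where the two affine functions cross
  let cr : Finset ℝ≥0 → ℝ≥0 := fun U => Real.toNNReal ((d U - c U) / ((n U : ℝ) - m U))
  refine ⟨S ∪ S.powerset.image cr, fun I hI hIe hIS => ?_⟩
  rcases I.eq_empty_or_nonempty with rfl | ⟨t₀, ht₀⟩
  · exact ⟨0, 0, fun t ht => absurd ht (notMem_empty t)⟩
  set U := S.filter (· < t₀) with hU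
  have key : ∀ a ∈ I, ∀ b ∈ I, a ≤ b → S.filter (· < a) = S.filter (· < b) := by
    intro a ha b hb hab
    ext s
    simp only [Finset.mem_filter]
    refine ⟨fun h => ⟨h.1, h.2.trans_le hab⟩, fun h => ⟨h.1, ?_⟩⟩
    by_contra hsa
    exact hIS s (hI.out ha hb ⟨not_lt.1 hsa, h.2.le⟩) (Finset.mem_union_left _ h.1)
  have hIP : ∀ t ∈ I, t ∈ P U := by
    intro t ht
    refine ⟨hIe t ht, fun h => hIS t ht (Finset.mem_union_left _ h), ?_⟩
    rcases le_total t t₀ with h | h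
    · exact key t ht t₀ ht₀ h
    · exact (key t₀ ht₀ t ht h).symm
  have hcr : cr U ∉ I := fun h => hIS _ h (Finset.mem_union_right _
    (Finset.mem_image.2 ⟨U, Finset.mem_powerset.2 (Finset.filter_subset _ _), rfl⟩))
  have hdich : (∀ t ∈ I, (m U : ℝ) * t + d U ≤ n U * t + c U) ∨
      (∀ t ∈ I, (n U : ℝ) * t + c U ≤ m U * t + d U) := by
    by_contra hcon
    push Not at hcon
    obtain ⟨⟨a, ha, hab⟩, ⟨b, hb, hba⟩⟩ := hcon
    set k : ℝ := (n U : ℝ) - m U with hk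
    set q : ℝ := (d U - c U) / k with hq
    have h1 : k * a < d U - c U := by rw [hk]; linarith
    have h2 : d U - c U < k * b := by rw [hk]; linarith
    have hk0 : k ≠ 0 := by
      rintro h0
      rw [h0] at h1 h2
      linarith
    have hkq : d U - c U = k * q := by rw [hq]; field_simp
    rw [hkq] at h1 h2
    have hmem : cr U ∈ I := by
      rcases lt_or_gt_of_ne hk0 with hneg | hpos
      · have ha' : q < a := by nlinarith
        have hb' : (b : ℝ) < q := by nlinarith
        refine hI.out hb ha ⟨?_, ?_⟩
        · exact NNReal.le_toNNReal_of_coe_le hb'.le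
        · exact Real.toNNReal_le_iff_le_coe.2 ha'.le
      · have ha' : (a : ℝ) < q := by nlinarith
        have hb' : q < b := by nlinarith
        refine hI.out ha hb ⟨?_, ?_⟩
        · exact NNReal.le_toNNReal_of_coe_le ha'.le
        · exact Real.toNNReal_le_iff_le_coe.2 hb'.le
    exact hcr hmem
  rcases hdich with h | h
  · refine ⟨n U, c U, fun t ht => ?_⟩
    change Max.max _ _ = _
    rw [hnc U t (hIP t ht), hmd U t (hIP t ht)]
    exact max_eq_left (EReal.coe_le_coe_iff.2 (h t ht))
  · refine ⟨m U, d U, fun t ht => ?_⟩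
    change Max.max _ _ = _
    rw [hnc U t (hIP t ht), hmd U t (hIP t ht)]
    exact max_eq_right (EReal.coe_le_coe_iff.2 (h t ht))

/-- A piecewise affine function has a limit at each point at infinity. -/
theorem IsPiecewiseAffine.exists_tendsto [T2Space X] {h : X → EReal}
    (hh : Γ.IsPiecewiseAffine h) {e : Γ.E} (he : Γ.len e = ⊤) :
    ∃ y, Tendsto h (𝓝[Γ.finitePoints] (Γ.edge e ⊤)) (𝓝 y) := by
  classical
  obtain ⟨S, hS⟩ := hh e
  obtain ⟨B, hB⟩ := S.bddAbove
  obtain ⟨n, c, hnc⟩ := hS (Ioi B) ordConnected_Ioi (fun t _ => by rw [he]; exact le_top)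
    fun t ht hts => absurd (hB hts) (not_le.2 ht)
  suffices H : ∃ y, Tendsto (fun t : ℝ≥0 => h (Γ.edge e t)) atTop (𝓝 y) by
    obtain ⟨y, hy⟩ := H
    exact ⟨y, (tendsto_map'_iff.2 hy).mono_left (Γ.nhdsWithin_top_le he)⟩
  have hev : (fun t : ℝ≥0 => ((n * (t : ℝ) + c : ℝ) : EReal)) =ᶠ[atTop]
      fun t => h (Γ.edge e t) := by
    filter_upwards [eventually_gt_atTop B] with t ht
    exact (hnc t ht).symm
  have hcoe : Tendsto (fun t : ℝ≥0 => (t : ℝ)) atTop atTop := NNReal.tendsto_coe_atTop.2 tendsto_id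
  rcases lt_trichotomy n 0 with hn | rfl | hn
  · refine ⟨⊥, Tendsto.congr' hev (EReal.tendsto_coe_nhds_bot_iff.2 ?_)⟩
    exact tendsto_atBot_add_const_right _ _ (hcoe.const_mul_atTop_of_neg (by exact_mod_cast hn))
  · exact ⟨(c : EReal), Tendsto.congr' hev (by simp)⟩
  · refine ⟨⊤, Tendsto.congr' hev (EReal.tendsto_coe_nhds_top_iff.2 ?_)⟩
    exact tendsto_atTop_add_const_right _ _ (hcoe.const_mul_atTop (by exact_mod_cast hn))

namespace RatFun

instance : CoeFun Γ.RatFun fun _ => X → EReal := ⟨Subtype.val⟩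

theorem ext_of_finitePoints {f g : Γ.RatFun} (h : ∀ x ∈ Γ.finitePoints, f x = g x) : f = g :=
  Subtype.ext (Continuous.ext_on Γ.dense_finitePoints f.2.continuous g.2.continuous h)

theorem ne_top (f : Γ.RatFun) {x : X} (hx : x ∈ Γ.finitePoints) : f x ≠ ⊤ := by
  rcases f.2.eq_bot_or with h | h
  · rw [h x]
    exact bot_ne_top
  · exact (h.2 x hx).2

/-- The tropical sum of two rational functions is their pointwise maximum. -/
def sup (f g : Γ.RatFun) : Γ.RatFun :=
  ⟨fun x => max (f x) (g x), by
    refine ⟨f.2.continuous.max g.2.continuous, ?_⟩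
    rcases f.2.eq_bot_or with hf | hf
    · have : (fun x => max (f x) (g x)) = g := funext fun x => by rw [hf x]; exact max_bot_left _
      have h : Γ.IsRational fun x => max (f x) (g x) := by rw [this]; exact g.2
      exact h.eq_bot_or
    · rcases g.2.eq_bot_or with hg | hg
      · have : (fun x => max (f x) (g x)) = f := funext fun x => by rw [hg x]; exact max_bot_right _
        have h : Γ.IsRational fun x => max (f x) (g x) := by rw [this]; exact f.2
        exact h.eq_bot_or
      · refine Or.inr ⟨hf.1.max hg.1, fun x hx => ?_⟩
        rcases max_choice (f x) (g x) with h | h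
        · rw [h]
          exact hf.2 x hx
        · rw [h]
          exact hg.2 x hx⟩

theorem exists_tendsto_add [T2Space X] (f g : Γ.RatFun) (x : X) :
    ∃ y, Tendsto (fun z => f z + g z) (𝓝[Γ.finitePoints] x) (𝓝 y) := by
  by_cases hx : x ∈ Γ.finitePoints
  · refine ⟨f x + g x, ?_⟩
    have hc := EReal.continuousAt_add (p := (f x, g x)) (Or.inl (f.ne_top hx))
      (Or.inr (g.ne_top hx))
    exact (hc.tendsto.comp
      ((f.2.continuous.prodMk g.2.continuous).tendsto x)).mono_left nhdsWithin_le_nhds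
  · obtain ⟨e, he, rfl⟩ : x ∈ Γ.infinitePoints := not_not.1 hx
    rcases f.2.eq_bot_or with hf | hf
    · exact ⟨⊥, by simpa [hf] using tendsto_const_nhds⟩
    · rcases g.2.eq_bot_or with hg | hg
      · exact ⟨⊥, by simpa [hg] using tendsto_const_nhds⟩
      · exact (hf.1.add hg.1 fun _ _ => rfl).exists_tendsto he

theorem extendFrom_add_apply [T2Space X] (f g : Γ.RatFun) {x : X} (hx : x ∈ Γ.finitePoints) :
    extendFrom Γ.finitePoints (fun z => f z + g z) x = f x + g x := by
  refine extendFrom_eq (subset_closure hx) ?_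
  have hc := EReal.continuousAt_add (p := (f x, g x)) (Or.inl (f.ne_top hx))
    (Or.inr (g.ne_top hx))
  exact (hc.tendsto.comp
    ((f.2.continuous.prodMk g.2.continuous).tendsto x)).mono_left nhdsWithin_le_nhds

/-- The tropical product of two rational functions: their sum at the finite points, extended
to the points at infinity by continuity. -/
def prod [T2Space X] (f g : Γ.RatFun) : Γ.RatFun :=
  ⟨extendFrom Γ.finitePoints fun x => f x + g x, by
    have hc : Continuous (extendFrom Γ.finitePoints fun x => f x + g x) :=
      continuous_extendFrom Γ.dense_finitePoints (exists_tendsto_add f g)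
    refine ⟨hc, ?_⟩
    have hbot : (∀ x, f x + g x = ⊥) →
        ∀ x, extendFrom Γ.finitePoints (fun x => f x + g x) x = ⊥ := by
      intro h x
      refine extendFrom_eq (Γ.dense_finitePoints x) ?_
      simp only [h]
      exact tendsto_const_nhds
    rcases f.2.eq_bot_or with hf | hf
    · exact Or.inl (hbot fun x => by rw [hf x]; exact EReal.bot_add _)
    · rcases g.2.eq_bot_or with hg | hg
      · exact Or.inl (hbot fun x => by rw [hg x]; exact EReal.add_bot _)
      · refine Or.inr ⟨hf.1.add hg.1 fun x hx => extendFrom_add_apply f g hx, fun x hx => ?_⟩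
        rw [extendFrom_add_apply f g hx]
        refine ⟨fun h => ?_, fun h => ?_⟩
        · rcases EReal.add_eq_bot_iff.1 h with h | h
          · exact (hf.2 x hx).1 h
          · exact (hg.2 x hx).1 h
        · exact EReal.add_ne_top (hf.2 x hx).2 (hg.2 x hx).2 h⟩

theorem prod_apply [T2Space X] (f g : Γ.RatFun) {x : X} (hx : x ∈ Γ.finitePoints) :
    prod f g x = f x + g x := extendFrom_add_apply f g hx

variable (Γ) in
/-- The constant functions with values in `ℝ ∪ {-∞}`. -/
def const (t : TropicalSemifield) : Γ.RatFun :=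
  ⟨fun _ => t.toEReal, by
    refine ⟨continuous_const, ?_⟩
    induction t using WithBot.recBotCoe with
    | bot => exact Or.inl fun _ => rfl
    | coe r =>
      refine Or.inr ⟨fun e => ⟨∅, fun I _ _ _ => ⟨0, r, fun t _ => ?_⟩⟩, fun x _ =>
        ⟨EReal.coe_ne_bot r, EReal.coe_ne_top r⟩⟩
      simp only [Int.cast_zero, zero_mul, zero_add]
      rfl⟩

instance : Add Γ.RatFun := ⟨sup⟩

instance : Zero Γ.RatFun := ⟨const Γ 0⟩

instance [T2Space X] : Mul Γ.RatFun := ⟨prod⟩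

instance : One Γ.RatFun := ⟨const Γ 1⟩

/-- The semiring `Rat(Γ)`. -/
instance [T2Space X] : CommSemiring Γ.RatFun where
  add_assoc f g h := Subtype.ext (funext fun x => max_assoc (f x) (g x) (h x))
  zero_add f := Subtype.ext (funext fun x => max_bot_left (f x))
  add_zero f := Subtype.ext (funext fun x => max_bot_right (f x))
  add_comm f g := Subtype.ext (funext fun x => max_comm (f x) (g x))
  mul_assoc f g h := ext_of_finitePoints fun x hx => by
    change prod (prod f g) h x = prod f (prod g h) x
    simp only [prod_apply _ _ hx, add_assoc]
  one_mul f := ext_of_finitePoints fun x hx => by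
    change prod (const Γ 1) f x = f x
    rw [prod_apply _ _ hx]
    exact zero_add (f x)
  mul_one f := ext_of_finitePoints fun x hx => by
    change prod f (const Γ 1) x = f x
    rw [prod_apply _ _ hx]
    exact add_zero (f x)
  mul_comm f g := ext_of_finitePoints fun x hx => by
    change prod f g x = prod g f x
    simp only [prod_apply _ _ hx, add_comm]
  zero_mul f := ext_of_finitePoints fun x hx => by
    change prod (const Γ 0) f x = const Γ 0 x
    rw [prod_apply _ _ hx]
    exact EReal.bot_add _
  mul_zero f := ext_of_finitePoints fun x hx => by
    change prod f (const Γ 0) x = const Γ 0 x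
    rw [prod_apply _ _ hx]
    exact EReal.add_bot _
  left_distrib f g h := ext_of_finitePoints fun x hx => by
    change prod f (sup g h) x = max (prod f g x) (prod f h x)
    simp only [prod_apply _ _ hx]
    exact (max_add_add_left (f x) (g x) (h x)).symm
  right_distrib f g h := ext_of_finitePoints fun x hx => by
    change prod (sup f g) h x = max (prod f h x) (prod g h x)
    simp only [prod_apply _ _ hx]
    exact (max_add_add_right (f x) (g x) (h x)).symm
  nsmul := nsmulRec

/-- The inclusion of the tropical semifield into `Rat(Γ)` as constant functions. -/
def constHom [T2Space X] : TropicalSemifield →+* Γ.RatFun where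
  toFun := const Γ
  map_zero' := rfl
  map_one' := rfl
  map_add' a b := Subtype.ext (funext fun _ => TropicalSemifield.toEReal_add a b)
  map_mul' a b := ext_of_finitePoints fun x hx => by
    change const Γ (a * b) x = prod (const Γ a) (const Γ b) x
    rw [prod_apply _ _ hx]
    exact TropicalSemifield.toEReal_mul a b

/-- `Rat(Γ)` as an algebra over the tropical semifield. -/
instance [T2Space X] : Algebra TropicalSemifield Γ.RatFun := constHom.toAlgebra

end RatFun

end TropicalCurve

end

/-! Both groups are identified with a third one, the group of isometries of `Γ`: the
self-homeomorphisms that preserve the path distance, where the value `∞` is allowed.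

Isometries act on rational functions because rationality can be expressed without a model
(`isRational_iff`). Near a finite point `y`, the function is `f y` plus an integral multiple of the
distance from `y`; the integer may depend on the nearby point but stays bounded. Near a point at
infinity, the function is affine in the distance from a finite point. Conversely, continuity makes
the integer constant on each side of `y` in an edge, and compactness of the edges leaves finitely
many pieces.

Every algebra automorphism `Φ` arises in this way. For a point `x`, the functional `f ↦ Φ f x` is
the evaluation at some point `σ x` (`exists_forall_apply_eq`): otherwise compactness yields `g` with
`g > 0` everywhere and `Φ g x < 0`, but then `max 0 g = g`, that is `1 + g = g`, and so `0 ≤ Φ g x`.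
Rational functions separate points, hence `σ` is bijective, with the inverse that belongs to `Φ⁻¹`.
For finite `x`, the function `y ↦ dist (σ x) (σ y)` is the image under `Φ` of a distance function.
It is therefore rational, and near `x` it is an integral multiple of `dist x y`; by injectivity the
integer is positive, so it is at least `1`. Thus `σ` does not shrink small distances, and neither
does `σ⁻¹`; so small distances are preserved, and continuation along the edges turns this into a
global isometry.

Isometries and automorphisms are the same maps. Degree one forces all local degrees to be one and
makes the lifts of vertices and edges unique, so the morphism is a bijection that is isometric on
every edge (`IsHarmonicFor.bijective_and_dist_map`). Conversely, an isometry `σ` is harmonic of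
degree one from a loopless model to the image of this model under `σ`. -/

noncomputable section

/-! ### Distances in `[0, ∞]` -/

/-- The distance `|s - t|` of two points of `[0, ∞]`. -/
def gap (s t : ℝ≥0∞) : ℝ≥0∞ := (s - t) + (t - s)

theorem gap_self (s : ℝ≥0∞) : gap s s = 0 := by simp [gap]

theorem gap_comm (s t : ℝ≥0∞) : gap s t = gap t s := add_comm _ _

theorem gap_of_le {s t : ℝ≥0∞} (h : s ≤ t) : gap s t = t - s := by
  simp [gap, tsub_eq_zero_of_le h]

theorem gap_of_ge {s t : ℝ≥0∞} (h : t ≤ s) : gap s t = s - t := by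
  simp [gap, tsub_eq_zero_of_le h]

theorem gap_zero_left (t : ℝ≥0∞) : gap 0 t = t := by simp [gap]

theorem gap_triangle (s t u : ℝ≥0∞) : gap s u ≤ gap s t + gap t u := by
  have h1 : s - u ≤ (s - t) + (t - u) := tsub_le_tsub_add_tsub
  have h2 : u - s ≤ (u - t) + (t - s) := tsub_le_tsub_add_tsub
  calc gap s u ≤ ((s - t) + (t - u)) + ((u - t) + (t - s)) := add_le_add h1 h2
    _ = gap s t + gap t u := by unfold gap; ring

theorem eq_of_gap_eq_zero {s t : ℝ≥0∞} (h : gap s t = 0) : s = t := by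
  unfold gap at h
  rw [add_eq_zero] at h
  exact le_antisymm (tsub_eq_zero_iff_le.1 h.1) (tsub_eq_zero_iff_le.1 h.2)

theorem gap_top_left {t : ℝ≥0∞} (h : t ≠ ⊤) : gap ⊤ t = ⊤ := by
  simp [gap, ENNReal.top_sub h]

theorem gap_ne_top {s t : ℝ≥0∞} (hs : s ≠ ⊤) (ht : t ≠ ⊤) : gap s t ≠ ⊤ :=
  ENNReal.add_ne_top.2 ⟨ENNReal.sub_ne_top hs, ENNReal.sub_ne_top ht⟩

theorem toReal_gap_of_le {s t : ℝ≥0∞} (h : s ≤ t) (ht : t ≠ ⊤) :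
    (gap s t).toReal = t.toReal - s.toReal := by
  rw [gap_of_le h, ENNReal.toReal_sub_of_le h ht]

theorem toReal_gap_of_ge {s t : ℝ≥0∞} (h : t ≤ s) (hs : s ≠ ⊤) :
    (gap s t).toReal = s.toReal - t.toReal := by
  rw [gap_comm, toReal_gap_of_le h hs]

theorem le_add_gap (s t : ℝ≥0∞) : t ≤ s + gap s t := by
  have : t ≤ s + (t - s) := le_add_tsub
  exact this.trans (add_le_add le_rfl le_add_self)

theorem mem_Icc_of_gap_le {s u ε : ℝ≥0∞} (h : gap s u ≤ ε) : u ∈ Icc (s - ε) (s + ε) := by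
  refine ⟨?_, (le_add_gap s u).trans (add_le_add le_rfl h)⟩
  rw [tsub_le_iff_right]
  exact (le_add_gap u s).trans (add_le_add le_rfl ((gap_comm u s).le.trans h))

/-- A neighbourhood of a finite point contains all points at distance less than `1 / k`. -/
theorem eventually_forall_gap_lt {s : ℝ≥0∞} (hs : s ≠ ⊤) {Q : ℝ≥0∞ → Prop}
    (h : ∀ᶠ u in 𝓝 s, Q u) : ∀ᶠ k : ℕ in atTop, ∀ u, gap s u < (k : ℝ≥0∞)⁻¹ → Q u := by
  obtain ⟨ε, hε, H⟩ := (ENNReal.hasBasis_nhds_of_ne_top hs).eventually_iff.1 h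
  have h1 : ∀ᶠ k : ℕ in atTop, (k : ℝ≥0∞)⁻¹ < ε :=
    ENNReal.tendsto_inv_nat_nhds_zero.eventually (gt_mem_nhds hε)
  filter_upwards [h1] with k hk u hu
  exact H (mem_Icc_of_gap_le (hu.le.trans hk.le))

namespace TropicalCurve

variable {X : Type*} [TopologicalSpace X] (Γ : TropicalCurve X)

/-! ### The path distance -/

variable {Γ}

theorem IsPath.edge {x : X} {d : ℝ≥0∞} {e : Γ.E} {s t : ℝ≥0∞} (hs : s ≤ Γ.len e)
    (ht : t ≤ Γ.len e) (h : Γ.IsPath x (Γ.edge e s) d) :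
    Γ.IsPath x (Γ.edge e t) (d + gap s t) := IsPath.step x d e s t hs ht h

theorem IsPath.trans {x y z : X} {d d' : ℝ≥0∞} (h : Γ.IsPath x y d) (h' : Γ.IsPath y z d') :
    Γ.IsPath x z (d + d') := by
  induction h' with
  | refl => simpa using h
  | step d' e s t hs ht _ ih =>
    rw [← add_assoc]
    exact ih.edge hs ht

theorem IsPath.symm {x y : X} {d : ℝ≥0∞} (h : Γ.IsPath x y d) : Γ.IsPath y x d := by
  induction h with
  | refl => exact IsPath.refl x
  | step d e s t hs ht _ ih =>
    have h1 := (IsPath.refl (Γ := Γ) (Γ.edge e t)).edge ht hs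
    have h2 := h1.trans ih
    rwa [zero_add, add_comm, gap_comm] at h2

theorem dist_le_of_isPath {x y : X} {d : ℝ≥0∞} (h : Γ.IsPath x y d) : Γ.dist x y ≤ d := sInf_le h

variable (Γ)

theorem dist_self (x : X) : Γ.dist x x = 0 :=
  nonpos_iff_eq_zero.1 (dist_le_of_isPath (IsPath.refl x))

theorem dist_comm (x y : X) : Γ.dist x y = Γ.dist y x :=
  congrArg sInf (Set.ext fun _ => ⟨IsPath.symm, IsPath.symm⟩)

theorem dist_triangle (x y z : X) : Γ.dist x z ≤ Γ.dist x y + Γ.dist y z := by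
  unfold dist
  rw [ENNReal.sInf_add]
  refine le_iInf₂ fun d hd => ?_
  rw [ENNReal.add_sInf]
  exact le_iInf₂ fun d' hd' => sInf_le (hd.trans hd')

theorem dist_edge_le {e : Γ.E} {s t : ℝ≥0∞} (hs : s ≤ Γ.len e) (ht : t ≤ Γ.len e) :
    Γ.dist (Γ.edge e s) (Γ.edge e t) ≤ gap s t := by
  have := dist_le_of_isPath ((IsPath.refl (Γ := Γ) (Γ.edge e s)).edge hs ht)
  rwa [zero_add] at this

/-- A function that is `1`-Lipschitz on every edge is `1`-Lipschitz for the path distance. -/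
theorem le_add_dist_of_edge {g : X → ℝ≥0∞}
    (hg : ∀ e s t, s ≤ Γ.len e → t ≤ Γ.len e → g (Γ.edge e t) ≤ g (Γ.edge e s) + gap s t)
    (x y : X) : g y ≤ g x + Γ.dist x y := by
  unfold dist
  rw [ENNReal.add_sInf]
  refine le_iInf₂ fun d hd => ?_
  induction hd with
  | refl => simp
  | step d e s t hs ht _ ih =>
    calc g (Γ.edge e t) ≤ g (Γ.edge e s) + gap s t := hg e s t hs ht
      _ ≤ g x + d + gap s t := by gcongr
      _ = g x + (d + gap s t) := add_assoc _ _ _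

/-- A map that does not increase distances on any edge does not increase distances. -/
theorem dist_map_le_of_edge {Y : Type*} [TopologicalSpace Y] {Γ' : TropicalCurve Y} {φ : X → Y}
    (h : ∀ e s t, s ≤ Γ.len e → t ≤ Γ.len e →
      Γ'.dist (φ (Γ.edge e s)) (φ (Γ.edge e t)) ≤ gap s t) (x y : X) :
    Γ'.dist (φ x) (φ y) ≤ Γ.dist x y := by
  have := Γ.le_add_dist_of_edge (g := fun z => Γ'.dist (φ x) (φ z)) (fun e s t hs ht =>
    (Γ'.dist_triangle _ _ _).trans (add_le_add le_rfl (h e s t hs ht))) x y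
  simpa [Γ'.dist_self] using this

/-! ### Points of an edge -/

theorem zero_le_len (e : Γ.E) : (0 : ℝ≥0∞) ≤ Γ.len e := zero_le

/-- The gluing identifies nothing but ends of edges. In the second alternative `e` and `e'` may
still coincide: `s` and `t` can be the two ends of a loop. -/
theorem eq_or_endpoints_of_edge_eq {e e' : Γ.E} {s t : ℝ≥0∞} (hs : s ≤ Γ.len e)
    (ht : t ≤ Γ.len e') (h : Γ.edge e s = Γ.edge e' t) :
    (e = e' ∧ s = t) ∨ ((s = 0 ∨ s = Γ.len e) ∧ (t = 0 ∨ t = Γ.len e')) := by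
  have key : ∀ (e : Γ.E) (s : ℝ≥0∞), s ≤ Γ.len e →
      s ∈ Ioo 0 (Γ.len e) ∨ ((s = 0 ∨ s = Γ.len e) ∧ ∃ v, Γ.edge e s = Γ.point v) := by
    intro e s hs
    rcases eq_or_ne s 0 with rfl | h0
    · exact Or.inr ⟨Or.inl rfl, _, Γ.edge_zero e⟩
    · rcases eq_or_lt_of_le hs with rfl | hlt
      · exact Or.inr ⟨Or.inr rfl, _, Γ.edge_len e⟩
      · exact Or.inl ⟨pos_iff_ne_zero.2 h0, hlt⟩
  rcases key e s hs with h1 | ⟨h1, v, hv⟩ <;> rcases key e' t ht with h2 | ⟨h2, w, hw⟩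
  · exact Or.inl (Γ.edge_injective e e' s t h1 h2 h)
  · exact absurd (h.trans hw) (Γ.edge_ne_point e s h1 w)
  · exact absurd (h.symm.trans hv) (Γ.edge_ne_point e' t h2 v)
  · exact Or.inr ⟨h1, h2⟩

theorem finite_edge_fiber (e : Γ.E) (y : X) : {s | s ≤ Γ.len e ∧ Γ.edge e s = y}.Finite := by
  by_cases h : ∃ s₀ ∈ Ioo 0 (Γ.len e), Γ.edge e s₀ = y
  · obtain ⟨s₀, h0, rfl⟩ := h
    refine (Set.toFinite {s₀}).subset fun s ⟨hs, h⟩ => ?_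
    rcases Γ.eq_or_endpoints_of_edge_eq hs h0.2.le h with h | ⟨-, h | h⟩
    · exact h.2
    · exact absurd h h0.1.ne'
    · exact absurd h h0.2.ne
  · refine (Set.toFinite {0, Γ.len e}).subset fun s ⟨hs, hy⟩ => ?_
    by_contra hne
    simp only [mem_insert_iff, mem_singleton_iff, not_or] at hne
    exact h ⟨s, ⟨pos_iff_ne_zero.2 hne.1, lt_of_le_of_ne hs hne.2⟩, hy⟩

/-- A radius such that the ball around `y` is a star. -/
structure IsLocalScale (y : X) (ε : ℝ≥0∞) : Prop where
  pos : 0 < ε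
  add_le_left : ∀ e s, s ≤ Γ.len e → Γ.edge e s = y → s ≠ 0 → ε + ε ≤ s
  add_le_right : ∀ e s, s ≤ Γ.len e → Γ.edge e s = y → s ≠ Γ.len e → ε + ε ≤ Γ.len e - s
  add_le_len : ∀ e, ε + ε ≤ Γ.len e

theorem exists_isLocalScale (y : X) : ∃ ε, Γ.IsLocalScale y ε := by
  have h : ∀ e : Γ.E, ∃ η, 0 < η ∧ η ≤ Γ.len e ∧ ∀ s, s ≤ Γ.len e → Γ.edge e s = y →
      (s ≠ 0 → η ≤ s) ∧ (s ≠ Γ.len e → η ≤ Γ.len e - s) := by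
    intro e
    have hfin := Γ.finite_edge_fiber e y
    have hfin' : ({s | s ≤ Γ.len e ∧ Γ.edge e s = y} ∪ {Γ.len e} ∪
      (fun s => Γ.len e - s) '' {s | s ≤ Γ.len e ∧ Γ.edge e s = y}).Finite :=
      (hfin.union (finite_singleton _)).union (hfin.image _)
    classical
    -- A minimum of finitely many positive numbers: the parameters of `y` on `e`, their distances
    -- from the far end, and the length of `e`. The zeros, which occur when `y` is an end of `e`,
    -- are discarded.
    refine ⟨(hfin'.toFinset.filter fun s => s ≠ 0).inf id, ?_, ?_, fun s hs hy => ⟨?_, ?_⟩⟩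
    · rw [Finset.lt_inf_iff (by simp)]
      intro s hs
      exact pos_iff_ne_zero.2 (Finset.mem_filter.1 hs).2
    · refine Finset.inf_le (f := id) ?_
      simp [(Γ.len_pos e).ne']
    · intro h0
      refine Finset.inf_le (f := id) ?_
      simp [h0, hs, hy]
    · intro h0
      refine Finset.inf_le (f := id) ?_
      have : Γ.len e - s ≠ 0 := (tsub_pos_of_lt (lt_of_le_of_ne hs h0)).ne'
      rw [Finset.mem_filter]
      refine ⟨?_, this⟩
      rw [Set.Finite.mem_toFinset]
      exact Or.inr ⟨s, ⟨hs, hy⟩, rfl⟩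
  choose η h0 hlen hη using h
  set ε := Finset.univ.inf η with hε
  have hε0 : 0 < ε := by
    rw [Finset.lt_inf_iff (by simp)]
    exact fun e _ => h0 e
  have hle : ∀ e, ε ≤ η e := fun e => Finset.inf_le (Finset.mem_univ e)
  -- Halving leaves room for the doubled radius in `IsLocalScale`, which `IsLocalScale.dist_edge`
  -- needs in order to tell the two ends of a loop apart.
  refine ⟨ε / 2, ?_, ?_, ?_, ?_⟩
  · exact ENNReal.half_pos hε0.ne'
  all_goals rw [ENNReal.add_halves]
  · exact fun e s hs hy h => (hle e).trans ((hη e s hs hy).1 h)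
  · exact fun e s hs hy h => (hle e).trans ((hη e s hs hy).2 h)
  · exact fun e => (hle e).trans (hlen e)

variable {Γ}

theorem IsLocalScale.eq_of_gap_lt {y : X} {ε : ℝ≥0∞} (h : Γ.IsLocalScale y ε) {e : Γ.E}
    {s t : ℝ≥0∞} (hs : s ≤ Γ.len e) (hy : Γ.edge e s = y) (ht : t = 0 ∨ t = Γ.len e)
    (hst : gap s t < ε) : s = t := by
  by_contra hne
  have h1 : gap s t < ε + ε := hst.trans_le le_self_add
  rcases ht with rfl | rfl
  · rw [gap_comm, gap_zero_left] at h1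
    exact absurd (h.add_le_left e s hs hy hne) (not_le.2 h1)
  · rw [gap_of_le hs] at h1
    exact absurd (h.add_le_right e s hs hy hne) (not_le.2 h1)

/-- A path can change edges only at a vertex, and a path from `y` that is shorter than `ε` meets no
vertex except possibly `y` itself. So only the part after its last change of edge counts, and this
part starts at `y`. -/
theorem IsLocalScale.of_isPath {y : X} {ε : ℝ≥0∞} (h : Γ.IsLocalScale y ε) {z : X} {d : ℝ≥0∞}
    (hp : Γ.IsPath y z d) : ε ≤ d ∨ z = y ∨
      ∃ e s t, s ≤ Γ.len e ∧ t ≤ Γ.len e ∧ Γ.edge e s = y ∧ Γ.edge e t = z ∧ gap s t ≤ d := by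
  induction hp with
  | refl => exact Or.inr (Or.inl rfl)
  | step d e s t hs ht _ ih =>
    have key : Γ.edge e s = y → ∃ e' s' t', s' ≤ Γ.len e' ∧ t' ≤ Γ.len e' ∧
        Γ.edge e' s' = y ∧ Γ.edge e' t' = Γ.edge e t ∧ gap s' t' ≤ d + gap s t :=
      fun hy => ⟨e, s, t, hs, ht, hy, rfl, le_add_self⟩
    rcases le_or_gt ε d with hd | hd
    · exact Or.inl (hd.trans le_self_add)
    rcases ih with hd' | hy | ⟨e₁, s₁, t₁, hs₁, ht₁, hy, hz, hg⟩
    · exact absurd hd' (not_le.2 hd)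
    · exact Or.inr (Or.inr (key hy))
    · rcases Γ.eq_or_endpoints_of_edge_eq ht₁ hs hz with ⟨rfl, rfl⟩ | ⟨h1, -⟩
      · exact Or.inr (Or.inr ⟨e₁, s₁, t, hs₁, ht, hy, rfl,
          (gap_triangle _ _ _).trans (add_le_add hg le_rfl)⟩)
      · have := h.eq_of_gap_lt hs₁ hy h1 (hg.trans_lt hd)
        exact Or.inr (Or.inr (key (by rw [← hz, ← this, hy])))

/-- Within the local scale, the path distance is the distance along an edge. -/
theorem IsLocalScale.dist_edge {y : X} {ε : ℝ≥0∞} (h : Γ.IsLocalScale y ε) {e : Γ.E}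
    {s t : ℝ≥0∞} (hs : s ≤ Γ.len e) (ht : t ≤ Γ.len e) (hy : Γ.edge e s = y)
    (hst : gap s t < ε) : Γ.dist y (Γ.edge e t) = gap s t := by
  refine le_antisymm (hy ▸ Γ.dist_edge_le hs ht) (le_sInf fun d hd => ?_)
  by_contra hlt
  rw [not_le] at hlt
  have hdε := hlt.trans hst
  have hend : ¬ (t = 0 ∨ t = Γ.len e) := fun h' => by
    rw [h.eq_of_gap_lt hs hy h' hst, gap_self] at hlt
    exact not_lt_zero hlt
  rcases h.of_isPath hd with h1 | h1 | ⟨e₁, s₁, t₁, hs₁, ht₁, hy₁, hz, hg⟩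
  · exact absurd h1 (not_le.2 hdε)
  · rcases Γ.eq_or_endpoints_of_edge_eq ht hs (h1.trans hy.symm) with ⟨-, rfl⟩ | ⟨h2, -⟩
    · rw [gap_self] at hlt
      exact not_lt_zero hlt
    · exact hend h2
  · rcases Γ.eq_or_endpoints_of_edge_eq ht₁ ht hz with ⟨rfl, rfl⟩ | ⟨-, h2⟩
    · rcases Γ.eq_or_endpoints_of_edge_eq hs₁ hs (hy₁.trans hy.symm) with ⟨-, rfl⟩ | ⟨h3, h4⟩
      · exact absurd hg (not_le.2 hlt)
      -- Two parameters of `y` on one edge that are both ends: if they differ, the edge is a loop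
      -- and their gap is its full length, which the doubled radius excludes.
      · have h5 : gap s₁ s < Γ.len e₁ := by
          calc gap s₁ s ≤ gap s₁ t₁ + gap t₁ s := gap_triangle _ _ _
            _ < ε + ε := ENNReal.add_lt_add (hg.trans_lt hdε) (by rwa [gap_comm])
            _ ≤ Γ.len e₁ := h.add_le_len e₁
        rcases h3 with rfl | rfl <;> rcases h4 with rfl | rfl
        · exact absurd hg (not_le.2 hlt)
        · rw [gap_zero_left] at h5
          exact lt_irrefl _ h5
        · rw [gap_comm, gap_zero_left] at h5
          exact lt_irrefl _ h5
        · exact absurd hg (not_le.2 hlt)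
    · exact hend h2

/-- A point within the local scale lies on an edge through the centre. -/
theorem IsLocalScale.exists_edge {y : X} {ε : ℝ≥0∞} (h : Γ.IsLocalScale y ε) {z : X}
    (hz : Γ.dist y z < ε) : z = y ∨ ∃ e s t, s ≤ Γ.len e ∧ t ≤ Γ.len e ∧ Γ.edge e s = y ∧
      Γ.edge e t = z ∧ Γ.dist y z = gap s t := by
  obtain ⟨d, hd, hlt⟩ := sInf_lt_iff.1 hz
  rcases h.of_isPath hd with h1 | h1 | ⟨e, s, t, hs, ht, hy, rfl, hg⟩
  · exact absurd h1 (not_le.2 hlt)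
  · exact Or.inl h1
  · exact Or.inr ⟨e, s, t, hs, ht, hy, rfl, h.dist_edge hs ht hy (hg.trans_lt hlt)⟩

variable (Γ)

theorem eq_of_dist_eq_zero {x y : X} (h : Γ.dist x y = 0) : x = y := by
  obtain ⟨ε, hε⟩ := Γ.exists_isLocalScale x
  rcases hε.exists_edge (h ▸ hε.pos) with h1 | ⟨e, s, t, -, -, rfl, rfl, h2⟩
  · exact h1.symm
  · rw [eq_of_gap_eq_zero (h2.symm.trans h)]

/-! ### The distance from a point to the points of an edge -/

theorem dist_edge_le_src (x : X) {e : Γ.E} {t : ℝ≥0∞} (ht : t ≤ Γ.len e) :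
    Γ.dist x (Γ.edge e t) ≤ Γ.dist x (Γ.point (Γ.src e)) + t := by
  have := Γ.dist_edge_le (Γ.zero_le_len e) ht
  rw [gap_zero_left, Γ.edge_zero] at this
  exact (Γ.dist_triangle _ _ _).trans (add_le_add le_rfl this)

theorem dist_edge_le_tgt (x : X) {e : Γ.E} {t : ℝ≥0∞} (ht : t ≤ Γ.len e) :
    Γ.dist x (Γ.edge e t) ≤ Γ.dist x (Γ.point (Γ.tgt e)) + (Γ.len e - t) := by
  have := Γ.dist_edge_le (e := e) le_rfl ht
  rw [gap_of_ge ht, Γ.edge_len] at this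
  exact (Γ.dist_triangle _ _ _).trans (add_le_add le_rfl this)

/-- The last entrance of the path into the edge decides: it is through the source, through the
target, or there is none and the path has started in the interior of the edge. The two formulas
below follow from this; they show that distance functions are continuous and piecewise affine. -/
theorem le_of_isPath {x z : X} {d : ℝ≥0∞} (h : Γ.IsPath x z d) : ∀ e t, t ≤ Γ.len e →
    z = Γ.edge e t → Γ.dist x (Γ.point (Γ.src e)) + t ≤ d ∨
      Γ.dist x (Γ.point (Γ.tgt e)) + (Γ.len e - t) ≤ d ∨
      ∃ s ∈ Ioo 0 (Γ.len e), Γ.edge e s = x ∧ gap s t ≤ d := by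
  have ends : ∀ {z d}, Γ.IsPath x z d → ∀ e t, z = Γ.edge e t → t = 0 ∨ t = Γ.len e →
      Γ.dist x (Γ.point (Γ.src e)) + t ≤ d ∨
      Γ.dist x (Γ.point (Γ.tgt e)) + (Γ.len e - t) ≤ d := by
    rintro z d h e t rfl (rfl | rfl)
    · left
      rw [add_zero, ← Γ.edge_zero]
      exact dist_le_of_isPath h
    · right
      rw [tsub_self, add_zero, ← Γ.edge_len]
      exact dist_le_of_isPath h
  induction h with
  | refl =>
    intro e t ht hx
    by_cases h : t = 0 ∨ t = Γ.len e
    · rcases ends (IsPath.refl x) e t hx h with h | h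
      · exact Or.inl h
      · exact Or.inr (Or.inl h)
    · rw [not_or] at h
      exact Or.inr (Or.inr ⟨t, ⟨pos_iff_ne_zero.2 h.1, lt_of_le_of_ne ht h.2⟩, hx.symm,
        (gap_self t).le⟩)
  | step d e₁ s₁ t₁ hs₁ ht₁ hp ih =>
    intro e t ht hz
    rcases Γ.eq_or_endpoints_of_edge_eq ht₁ ht hz with ⟨rfl, rfl⟩ | ⟨-, h⟩
    · rcases ih e₁ s₁ hs₁ rfl with h | h | ⟨s, hs, hx, hg⟩
      · left
        calc _ ≤ Γ.dist x (Γ.point (Γ.src e₁)) + (s₁ + gap s₁ t₁) :=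
              add_le_add le_rfl (le_add_gap _ _)
          _ ≤ _ := by rw [← add_assoc]; exact add_le_add h le_rfl
      · right; left
        have : Γ.len e₁ - t₁ ≤ (Γ.len e₁ - s₁) + gap s₁ t₁ :=
          tsub_le_tsub_add_tsub.trans (add_le_add le_rfl le_self_add)
        calc _ ≤ Γ.dist x (Γ.point (Γ.tgt e₁)) + ((Γ.len e₁ - s₁) + gap s₁ t₁) :=
              add_le_add le_rfl this
          _ ≤ _ := by rw [← add_assoc]; exact add_le_add h le_rfl
      · exact Or.inr (Or.inr ⟨s, hs, hx, (gap_triangle _ _ _).trans (add_le_add hg le_rfl)⟩)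
    · rcases ends (hp.edge hs₁ ht₁) e t hz h with h | h
      · exact Or.inl h
      · exact Or.inr (Or.inl h)

theorem dist_edge_of_interior {e : Γ.E} {s t : ℝ≥0∞} (hs : s ∈ Ioo 0 (Γ.len e))
    (ht : t ≤ Γ.len e) :
    Γ.dist (Γ.edge e s) (Γ.edge e t) = min (min (Γ.dist (Γ.edge e s) (Γ.point (Γ.src e)) + t)
      (Γ.dist (Γ.edge e s) (Γ.point (Γ.tgt e)) + (Γ.len e - t))) (gap s t) := by
  refine le_antisymm (le_min (le_min (Γ.dist_edge_le_src _ ht) (Γ.dist_edge_le_tgt _ ht))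
    (Γ.dist_edge_le hs.2.le ht)) (le_sInf fun d hd => ?_)
  rcases Γ.le_of_isPath hd e t ht rfl with h | h | ⟨s', hs', hx, hg⟩
  · exact (min_le_left _ _).trans ((min_le_left _ _).trans h)
  · exact (min_le_left _ _).trans ((min_le_right _ _).trans h)
  · rw [(Γ.edge_injective _ _ _ _ hs' hs hx).2] at hg
    exact (min_le_right _ _).trans hg

theorem dist_edge_of_forall_ne {x : X} {e : Γ.E} {t : ℝ≥0∞}
    (hx : ∀ s ∈ Ioo 0 (Γ.len e), Γ.edge e s ≠ x) (ht : t ≤ Γ.len e) :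
    Γ.dist x (Γ.edge e t) = min (Γ.dist x (Γ.point (Γ.src e)) + t)
      (Γ.dist x (Γ.point (Γ.tgt e)) + (Γ.len e - t)) := by
  refine le_antisymm (le_min (Γ.dist_edge_le_src _ ht) (Γ.dist_edge_le_tgt _ ht))
    (le_sInf fun d hd => ?_)
  rcases Γ.le_of_isPath hd e t ht rfl with h | h | ⟨s', hs', h, -⟩
  · exact (min_le_left _ _).trans h
  · exact (min_le_right _ _).trans h
  · exact absurd h (hx s' hs')

/-! ### Points at infinity -/

/-- A point at infinity has only one parameter, the value `∞` on its leaf edge, and a segment from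
there to any other parameter has length `∞`. -/
theorem dist_eq_top_of_infinite {x y : X} (hx : x ∈ Γ.infinitePoints) (hxy : y ≠ x) :
    Γ.dist x y = ⊤ := by
  obtain ⟨e, he, rfl⟩ := hx
  have key : ∀ {z d}, Γ.IsPath (Γ.edge e ⊤) z d → z = Γ.edge e ⊤ ∨ d = ⊤ := by
    intro z d h
    induction h with
    | refl => exact Or.inl rfl
    | step d e₁ s t hs ht _ ih =>
      rcases ih with h | rfl
      · obtain ⟨rfl, rfl⟩ := Γ.eq_of_edge_eq_top he hs h
        rcases eq_or_ne t ⊤ with rfl | hne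
        · exact Or.inl rfl
        · right
          change _ + gap ⊤ t = ⊤
          rw [gap_top_left hne, add_top]
      · exact Or.inr (top_add _)
  refine top_le_iff.1 (le_sInf fun d hd => ?_)
  rcases key hd with h | h
  · exact absurd h hxy
  · exact h.ge

theorem edge_mem_finitePoints {e : Γ.E} {t : ℝ≥0∞} (ht : t ≤ Γ.len e) (h : t ≠ ⊤) :
    Γ.edge e t ∈ Γ.finitePoints := by
  lift t to ℝ≥0 using h
  exact Γ.edge_coe_mem_finitePoints e t ht

theorem ne_top_of_edge_mem_finitePoints {e : Γ.E} {t : ℝ≥0∞} (ht : t ≤ Γ.len e)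
    (h : Γ.edge e t ∈ Γ.finitePoints) : t ≠ ⊤ := by
  rintro rfl
  exact h ⟨e, top_le_iff.1 ht, rfl⟩

theorem point_src_mem_finitePoints (e : Γ.E) : Γ.point (Γ.src e) ∈ Γ.finitePoints := by
  rw [← Γ.edge_zero]
  exact Γ.edge_mem_finitePoints (Γ.zero_le_len e) ENNReal.zero_ne_top

theorem point_tgt_mem_finitePoints {e : Γ.E} (he : Γ.len e ≠ ⊤) :
    Γ.point (Γ.tgt e) ∈ Γ.finitePoints := by
  rw [← Γ.edge_len]
  exact Γ.edge_mem_finitePoints le_rfl he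

theorem point_tgt_mem_infinitePoints {e : Γ.E} (he : Γ.len e = ⊤) :
    Γ.point (Γ.tgt e) ∈ Γ.infinitePoints := by
  refine ⟨e, he, ?_⟩
  rw [← Γ.edge_len, he]

theorem dist_src_tgt_ne_top {e : Γ.E} (he : Γ.len e ≠ ⊤) :
    Γ.dist (Γ.point (Γ.src e)) (Γ.point (Γ.tgt e)) ≠ ⊤ := by
  have := Γ.dist_edge_le (Γ.zero_le_len e) (le_refl (Γ.len e))
  rw [gap_zero_left, Γ.edge_zero, Γ.edge_len] at this
  exact (this.trans_lt (lt_top_iff_ne_top.2 he)).ne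

theorem dist_ne_top_trans {x y z : X} (h : Γ.dist x y ≠ ⊤) (h' : Γ.dist y z ≠ ⊤) :
    Γ.dist x z ≠ ⊤ :=
  ((Γ.dist_triangle x y z).trans_lt (ENNReal.add_lt_top.2 ⟨h.lt_top, h'.lt_top⟩)).ne

theorem dist_point_ne_top {u v : Γ.V} (hu : Γ.point u ∈ Γ.finitePoints)
    (hv : Γ.point v ∈ Γ.finitePoints) : Γ.dist (Γ.point u) (Γ.point v) ≠ ⊤ := by
  -- A walk in the graph may pass through a vertex at infinity, where the distance is useless. It
  -- has to return along the same leaf edge, so the second clause keeps a bound at the source of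
  -- this edge.
  have key : (Γ.point v ∈ Γ.finitePoints → Γ.dist (Γ.point u) (Γ.point v) ≠ ⊤) ∧
      ∀ e, Γ.len e = ⊤ → Γ.tgt e = v → Γ.dist (Γ.point u) (Γ.point (Γ.src e)) ≠ ⊤ := by
    clear hv
    induction Γ.connected.2 u v with
    | refl =>
      refine ⟨fun _ => by simp [Γ.dist_self], ?_⟩
      rintro e he rfl
      exact absurd (Γ.point_tgt_mem_infinitePoints he) hu
    | @tail a b _ hab ih =>
      obtain ⟨e, ⟨rfl, rfl⟩ | ⟨rfl, rfl⟩⟩ := hab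
      · have h1 := ih.1 (Γ.point_src_mem_finitePoints e)
        refine ⟨fun hf => ?_, fun e' he' heq => ?_⟩
        · have he : Γ.len e ≠ ⊤ := fun he => hf (Γ.point_tgt_mem_infinitePoints he)
          exact Γ.dist_ne_top_trans h1 (Γ.dist_src_tgt_ne_top he)
        · have : Γ.edge e (Γ.len e) = Γ.edge e' ⊤ := by
            rw [Γ.edge_len, ← he', Γ.edge_len, heq]
          obtain ⟨rfl, -⟩ := Γ.eq_of_edge_eq_top he' le_rfl this
          exact h1
      · refine ⟨fun _ => ?_, fun e' he' heq => ?_⟩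
        · by_cases he : Γ.len e = ⊤
          · exact ih.2 e he rfl
          · refine Γ.dist_ne_top_trans (ih.1 (Γ.point_tgt_mem_finitePoints he)) ?_
            rw [Γ.dist_comm]
            exact Γ.dist_src_tgt_ne_top he
        · have h1 := Γ.point_src_mem_finitePoints e
          rw [← heq] at h1
          exact absurd (Γ.point_tgt_mem_infinitePoints he') h1
  exact key.1 hv

theorem exists_point_dist_ne_top {x : X} (hx : x ∈ Γ.finitePoints) :
    ∃ v, Γ.point v ∈ Γ.finitePoints ∧ Γ.dist x (Γ.point v) ≠ ⊤ := by
  rcases Γ.cover x with ⟨v, rfl⟩ | ⟨e, s, hs, rfl⟩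
  · exact ⟨v, hx, by simp [Γ.dist_self]⟩
  · refine ⟨Γ.src e, Γ.point_src_mem_finitePoints e, ?_⟩
    have := Γ.dist_edge_le hs.2.le (Γ.zero_le_len e)
    rw [gap_comm, gap_zero_left, Γ.edge_zero] at this
    exact (this.trans_lt (hs.2.trans_le le_top)).ne

theorem dist_ne_top {x y : X} (hx : x ∈ Γ.finitePoints) (hy : y ∈ Γ.finitePoints) :
    Γ.dist x y ≠ ⊤ := by
  obtain ⟨u, hu, hxu⟩ := Γ.exists_point_dist_ne_top hx
  obtain ⟨v, hv, hyv⟩ := Γ.exists_point_dist_ne_top hy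
  refine Γ.dist_ne_top_trans hxu (Γ.dist_ne_top_trans (Γ.dist_point_ne_top hu hv) ?_)
  rwa [Γ.dist_comm]

theorem exists_incident [Nontrivial X] (v : Γ.V) : ∃ e, Γ.Incident e v := by
  by_contra hno
  push Not at hno
  have hall : ∀ w, w = v := by
    intro w
    induction Γ.connected.2 v w with
    | refl => rfl
    | tail _ hab ih =>
      obtain ⟨e, h | h⟩ := hab
      · exact absurd (Or.inl (h.1.trans ih)) (hno e)
      · exact absurd (Or.inr (h.2.trans ih)) (hno e)
  have hX : ∀ x, x = Γ.point v := by
    intro x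
    rcases Γ.cover x with ⟨w, rfl⟩ | ⟨e, -⟩
    · rw [hall w]
    · exact absurd (Or.inl (hall _)) (hno e)
  obtain ⟨x, y, hxy⟩ := exists_pair_ne X
  exact hxy ((hX x).trans (hX y).symm)

theorem exists_mem_edgeSet [Nontrivial X] (x : X) : ∃ e, x ∈ Γ.edgeSet e := by
  rcases Γ.cover x with ⟨v, rfl⟩ | ⟨e, s, hs, rfl⟩
  · obtain ⟨e, rfl | rfl⟩ := Γ.exists_incident v
    · exact ⟨e, 0, mem_Iic.2 zero_le, Γ.edge_zero e⟩
    · exact ⟨e, _, mem_Iic.2 le_rfl, Γ.edge_len e⟩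
  · exact ⟨e, s, hs.2.le, rfl⟩

/-- A point is at infinity if and only if it is at infinite distance from all other points and
there are other points. -/
theorem mem_infinitePoints_iff {x : X} :
    x ∈ Γ.infinitePoints ↔ (∃ y, y ≠ x) ∧ ∀ y, y ≠ x → Γ.dist x y = ⊤ := by
  constructor
  · intro hx
    refine ⟨?_, fun y => Γ.dist_eq_top_of_infinite hx⟩
    obtain ⟨e, he, rfl⟩ := hx
    exact ⟨Γ.edge e 0, fun h =>
      ENNReal.zero_ne_top (Γ.eq_of_edge_eq_top he (Γ.zero_le_len e) h).2⟩
  · rintro ⟨⟨y, hy⟩, h⟩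
    by_contra hx
    have : Nontrivial X := ⟨y, x, hy⟩
    obtain ⟨e, s, hs, rfl⟩ := Γ.exists_mem_edgeSet x
    have hs' : s ≠ ⊤ := Γ.ne_top_of_edge_mem_finitePoints hs hx
    -- Two different interior parameters, at least one of which is not `s`; it gives another finite
    -- point, which is at finite distance.
    obtain ⟨m, hm0, hml⟩ := exists_between (Γ.len_pos e)
    obtain ⟨m', hm', hml'⟩ := exists_between hml
    have hf : ∀ u, u ∈ Ioo 0 (Γ.len e) → u ≠ s → False := by
      intro u hu hne
      refine Γ.dist_ne_top hx (Γ.edge_mem_finitePoints hu.2.le (hu.2.trans_le le_top).ne)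
        (h _ fun heq => ?_)
      rcases Γ.eq_or_endpoints_of_edge_eq hu.2.le hs heq with ⟨-, h⟩ | ⟨h | h, -⟩
      · exact hne h
      · exact hu.1.ne' h
      · exact hu.2.ne h
    rcases eq_or_ne m s with rfl | hne
    · exact hf m' ⟨hm0.trans hm', hml'⟩ hm'.ne'
    · exact hf m ⟨hm0, hml⟩ hne

end TropicalCurve

/-! ### Germs of affine functions -/

/-- Along the filter `l`, the function `g` is finally affine with an integer slope. -/
def GermAffine (l : Filter ℝ≥0∞) (g : ℝ≥0∞ → EReal) : Prop :=
  ∃ (n : ℤ) (c : ℝ), ∀ᶠ u in l, g u = ((n * u.toReal + c : ℝ) : EReal)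

/-- The filter `l` is finally on one side of every real number and away from `∞`. -/
def OneSided (l : Filter ℝ≥0∞) : Prop :=
  (∀ᶠ u in l, u ≠ ⊤) ∧ ∀ q : ℝ, (∀ᶠ u in l, u.toReal ≤ q) ∨ ∀ᶠ u in l, q ≤ u.toReal

theorem oneSided_nhdsLT (t : ℝ≥0∞) : OneSided (𝓝[<] t) := by
  refine ⟨eventually_mem_nhdsWithin.mono fun u hu => (lt_of_lt_of_le hu le_top).ne, fun q => ?_⟩
  rcases lt_or_ge (ENNReal.ofReal q) t with h | h
  · right
    filter_upwards [eventually_mem_nhdsWithin, mem_nhdsWithin_of_mem_nhds (Ioi_mem_nhds h)]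
      with u hu hq
    exact (ENNReal.ofReal_le_iff_le_toReal (lt_of_lt_of_le hu le_top).ne).1 (le_of_lt hq)
  · rcases le_or_gt 0 q with h0 | h0
    · left
      filter_upwards [eventually_mem_nhdsWithin] with u hu
      exact ENNReal.toReal_le_of_le_ofReal h0 ((le_of_lt hu).trans h)
    · exact Or.inr (Eventually.of_forall fun u => h0.le.trans ENNReal.toReal_nonneg)

theorem oneSided_nhdsGT (t : ℝ≥0∞) : OneSided (𝓝[>] t) := by
  rcases eq_or_ne t ⊤ with rfl | ht
  · rw [show 𝓝[>] (⊤ : ℝ≥0∞) = ⊥ by simp]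
    exact ⟨eventually_bot, fun _ => Or.inl eventually_bot⟩
  have hne : ∀ᶠ u in 𝓝[>] t, u ≠ ⊤ :=
    mem_nhdsWithin_of_mem_nhds (mem_of_superset (Iio_mem_nhds ht.lt_top) fun u hu => ne_of_lt hu)
  refine ⟨hne, fun q => ?_⟩
  rcases lt_or_ge t (ENNReal.ofReal q) with h | h
  · left
    filter_upwards [mem_nhdsWithin_of_mem_nhds (Iio_mem_nhds h)] with u hq
    have hq0 : 0 < q := ENNReal.ofReal_pos.1 (lt_of_le_of_lt zero_le hq)
    exact ENNReal.toReal_le_of_le_ofReal hq0.le (le_of_lt hq)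
  · right
    filter_upwards [hne, eventually_mem_nhdsWithin] with u hu ht
    exact (ENNReal.ofReal_le_iff_le_toReal hu).1 (h.trans (le_of_lt ht))

theorem OneSided.le_or_ge {l : Filter ℝ≥0∞} (hl : OneSided l) {s : ℝ≥0∞} (hs : s ≠ ⊤) :
    (∀ᶠ u in l, u ≤ s) ∨ ∀ᶠ u in l, s ≤ u := by
  rcases hl.2 s.toReal with h | h
  · left
    filter_upwards [h, hl.1] with u hu hne
    exact (ENNReal.toReal_le_toReal hne hs).1 hu
  · right
    filter_upwards [h, hl.1] with u hu hne
    exact (ENNReal.toReal_le_toReal hs hne).1 hu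

theorem OneSided.affine_nonneg_or_nonpos {l : Filter ℝ≥0∞} (hl : OneSided l) (a b : ℝ) :
    (∀ᶠ u in l, 0 ≤ a * u.toReal + b) ∨ ∀ᶠ u in l, a * u.toReal + b ≤ 0 := by
  rcases lt_trichotomy a 0 with ha | rfl | ha
  · rcases hl.2 (-b / a) with h | h
    · left
      filter_upwards [h] with u hu
      rw [le_div_iff_of_neg ha] at hu
      linarith
    · right
      filter_upwards [h] with u hu
      rw [div_le_iff_of_neg ha] at hu
      linarith
  · rcases le_total 0 b with h | h
    · exact Or.inl (Eventually.of_forall fun u => by simpa using h)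
    · exact Or.inr (Eventually.of_forall fun u => by simpa using h)
  · rcases hl.2 (-b / a) with h | h
    · right
      filter_upwards [h] with u hu
      rw [le_div_iff₀ ha] at hu
      linarith
    · left
      filter_upwards [h] with u hu
      rw [div_le_iff₀ ha] at hu
      linarith

theorem GermAffine.congr {l : Filter ℝ≥0∞} {g h : ℝ≥0∞ → EReal} (hg : GermAffine l g)
    (hgh : ∀ᶠ u in l, h u = g u) : GermAffine l h := by
  obtain ⟨n, c, H⟩ := hg
  exact ⟨n, c, hgh.mp (H.mono fun u h1 h2 => h2.trans h1)⟩

/-- Along a one-sided filter the difference of two affine functions finally has a constant sign, so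
the minimum is finally one of the two. -/
theorem GermAffine.min {l : Filter ℝ≥0∞} (hl : OneSided l) {g h : ℝ≥0∞ → EReal}
    (hg : GermAffine l g) (hh : GermAffine l h) : GermAffine l fun u => min (g u) (h u) := by
  obtain ⟨n, c, hn⟩ := hg
  obtain ⟨m, d, hm⟩ := hh
  rcases hl.affine_nonneg_or_nonpos (m - n : ℝ) (d - c) with H | H
  · refine ⟨n, c, ?_⟩
    filter_upwards [hn, hm, H] with u h1 h2 h3
    rw [h1, h2, min_eq_left]
    rw [EReal.coe_le_coe_iff]
    linarith
  · refine ⟨m, d, ?_⟩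
    filter_upwards [hn, hm, H] with u h1 h2 h3
    rw [h1, h2, min_eq_right]
    rw [EReal.coe_le_coe_iff]
    linarith

theorem EReal.coe_ennreal_eq_coe_toReal {a : ℝ≥0∞} (ha : a ≠ ⊤) :
    ((a : ℝ≥0∞) : EReal) = ((a.toReal : ℝ) : EReal) := by
  lift a to ℝ≥0 using ha
  rfl

theorem germAffine_const_add {l : Filter ℝ≥0∞} (hl : OneSided l) {a : ℝ≥0∞} (ha : a ≠ ⊤) :
    GermAffine l fun u => ((a + u : ℝ≥0∞) : EReal) := by
  refine ⟨1, a.toReal, ?_⟩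
  filter_upwards [hl.1] with u hu
  rw [EReal.coe_ennreal_eq_coe_toReal (ENNReal.add_ne_top.2 ⟨ha, hu⟩), ENNReal.toReal_add ha hu]
  congr 1
  push_cast
  ring

theorem germAffine_add_sub {l : Filter ℝ≥0∞} (hl : OneSided l) {b L : ℝ≥0∞} (hb : b ≠ ⊤)
    (hL : L ≠ ⊤) (hle : ∀ᶠ u in l, u ≤ L) :
    GermAffine l fun u => ((b + (L - u) : ℝ≥0∞) : EReal) := by
  refine ⟨-1, b.toReal + L.toReal, ?_⟩
  filter_upwards [hl.1, hle] with u hu huL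
  rw [EReal.coe_ennreal_eq_coe_toReal (ENNReal.add_ne_top.2 ⟨hb, ENNReal.sub_ne_top hL⟩),
    ENNReal.toReal_add hb (ENNReal.sub_ne_top hL), ENNReal.toReal_sub_of_le huL hL]
  congr 1
  push_cast
  ring

theorem germAffine_gap {l : Filter ℝ≥0∞} (hl : OneSided l) {s : ℝ≥0∞} (hs : s ≠ ⊤) :
    GermAffine l fun u => ((gap s u : ℝ≥0∞) : EReal) := by
  rcases hl.le_or_ge hs with h | h
  · refine (germAffine_add_sub hl ENNReal.zero_ne_top hs h).congr ?_
    filter_upwards [h] with u hu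
    rw [gap_of_ge hu, zero_add]
  · refine ⟨1, -s.toReal, ?_⟩
    filter_upwards [h, hl.1] with u hu hne
    rw [EReal.coe_ennreal_eq_coe_toReal (gap_ne_top hs hne), toReal_gap_of_le hu hne]
    congr 1
    push_cast
    ring

theorem continuous_gap_right {s : ℝ≥0∞} (hs : s ≠ ⊤) : Continuous (gap s) :=
  (ENNReal.continuous_sub_left hs).add (ENNReal.continuous_sub_right s)

namespace TropicalCurve

variable {X : Type*} [TopologicalSpace X] {Γ : TropicalCurve X}

/-! ### Piecewise affine functions in terms of germs -/

theorem IsPiecewiseAffine.germAffine_nhdsLT {f : X → EReal} (hf : Γ.IsPiecewiseAffine f) (e : Γ.E)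
    {t : ℝ≥0∞} (ht : t ≤ Γ.len e) : GermAffine (𝓝[<] t) fun u => f (Γ.edge e u) := by
  obtain ⟨S, hS⟩ := hf e
  rcases eq_or_ne t 0 with rfl | h0
  · exact ⟨0, 0, by simp⟩
  have hfin : ((fun s : ℝ≥0 => (s : ℝ≥0∞)) '' S ∩ Iio t).Finite :=
    (S.finite_toSet.image _).inter_of_left _
  obtain ⟨a, ha, hsub⟩ := exists_Ioc_subset_of_mem_nhds
    (hfin.isClosed.isOpen_compl.mem_nhds fun h : t ∈ _ => lt_irrefl t h.2)
    ⟨0, pos_iff_ne_zero.2 h0⟩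
  obtain ⟨n, c, H⟩ := hS ((fun s : ℝ≥0 => (s : ℝ≥0∞)) ⁻¹' Ioo a t)
    (ordConnected_Ioo.preimage_mono ENNReal.coe_mono) (fun s hs => hs.2.le.trans ht)
    fun s hs hsS => hsub ⟨hs.1, hs.2.le⟩ ⟨⟨s, hsS, rfl⟩, hs.2⟩
  refine ⟨n, c, ?_⟩
  filter_upwards [Ioo_mem_nhdsLT ha] with u hu
  lift u to ℝ≥0 using (hu.2.trans_le le_top).ne
  exact H u hu

theorem IsPiecewiseAffine.germAffine_nhdsGT {f : X → EReal} (hf : Γ.IsPiecewiseAffine f) (e : Γ.E)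
    {t : ℝ≥0∞} (ht : t < Γ.len e) : GermAffine (𝓝[>] t) fun u => f (Γ.edge e u) := by
  obtain ⟨S, hS⟩ := hf e
  have hfin : ((fun s : ℝ≥0 => (s : ℝ≥0∞)) '' S ∩ Ioi t).Finite :=
    (S.finite_toSet.image _).inter_of_left _
  obtain ⟨b, hb, hsub⟩ := exists_Ico_subset_of_mem_nhds
    (hfin.isClosed.isOpen_compl.mem_nhds fun h : t ∈ _ => lt_irrefl t h.2) ⟨_, ht⟩
  obtain ⟨n, c, H⟩ := hS ((fun s : ℝ≥0 => (s : ℝ≥0∞)) ⁻¹' Ioo t (Min.min b (Γ.len e)))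
    (ordConnected_Ioo.preimage_mono ENNReal.coe_mono)
    (fun s hs => (hs.2.trans_le (min_le_right _ _)).le)
    fun s hs hsS => hsub ⟨hs.1.le, hs.2.trans_le (min_le_left _ _)⟩ ⟨⟨s, hsS, rfl⟩, hs.1⟩
  refine ⟨n, c, ?_⟩
  filter_upwards [Ioo_mem_nhdsGT (lt_min hb ht)] with u hu
  lift u to ℝ≥0 using (hu.2.trans_le le_top).ne
  exact H u hu

/-- Each one-sided germ provides an affine piece next to its point, and by compactness of `[0, len
e]` in `[0, ∞]` finitely many breakpoints suffice. The left germ at `∞` is among the hypotheses and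
takes care of the unbounded last piece. -/
theorem isPiecewiseAffine_of_germAffine {f : X → EReal}
    (hl : ∀ e, ∀ t ≤ Γ.len e, GermAffine (𝓝[<] t) fun u => f (Γ.edge e u))
    (hr : ∀ e, ∀ t < Γ.len e, GermAffine (𝓝[>] t) fun u => f (Γ.edge e u)) :
    Γ.IsPiecewiseAffine f := by
  classical
  intro e
  let A : Set ℝ≥0 → Prop := fun I => ∃ (n : ℤ) (c : ℝ), ∀ t ∈ I,
    f (Γ.edge e t) = ((n * (t : ℝ) + c : ℝ) : EReal)
  -- Only intervals that meet `K` are required to be single pieces. This makes `P` stable under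
  -- unions, as compact induction demands: an interval that meets `K ∪ K'` meets one of the two.
  let P : Set ℝ≥0∞ → Prop := fun K => ∃ S : Finset ℝ≥0, ∀ I : Set ℝ≥0, I.OrdConnected →
    (∀ t ∈ I, (t : ℝ≥0∞) ≤ Γ.len e) → (∀ t ∈ I, t ∉ S) → (∃ t ∈ I, (t : ℝ≥0∞) ∈ K) → A I
  have hunion : ∀ K K', P K → P K' → P (K ∪ K') := by
    rintro K K' ⟨S, hS⟩ ⟨S', hS'⟩
    refine ⟨S ∪ S', fun I hI hIe hIS ⟨t, ht, htK⟩ => ?_⟩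
    rcases htK with htK | htK
    · exact hS I hI hIe (fun t ht hts => hIS t ht (Finset.mem_union_left _ hts)) ⟨t, ht, htK⟩
    · exact hS' I hI hIe (fun t ht hts => hIS t ht (Finset.mem_union_right _ hts)) ⟨t, ht, htK⟩
  have hmono : ∀ K K', K ⊆ K' → P K' → P K := by
    rintro K K' hKK ⟨S, hS⟩
    exact ⟨S, fun I hI hIe hIS ⟨t, ht, htK⟩ => hS I hI hIe hIS ⟨t, ht, hKK htK⟩⟩
  have hempty : P ∅ := ⟨∅, fun I _ _ _ ⟨t, _, ht⟩ => ht.elim⟩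
  -- an interval that is bounded by two excluded points
  have hIoo : ∀ {a b : ℝ≥0∞}, a ≠ ⊤ → (∃ (n : ℤ) (c : ℝ), ∀ u ∈ Ioo a b,
      f (Γ.edge e u) = ((n * u.toReal + c : ℝ) : EReal)) → P (Ioo a b) := by
    rintro a b ha ⟨n, c, H⟩
    -- For `b = ∞` the value `b.toNNReal` is `0`, a superfluous but harmless breakpoint.
    refine ⟨{a.toNNReal, b.toNNReal}, fun I hI hIe hIS ⟨t, ht, hta, htb⟩ =>
      ⟨n, c, fun t' ht' => H t' ⟨?_, ?_⟩⟩⟩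
    · by_contra hle
      rw [not_lt] at hle
      lift a to ℝ≥0 using ha
      refine hIS a (hI.out ht' ht ⟨?_, ?_⟩) (by simp)
      · exact_mod_cast hle
      · exact_mod_cast hta.le
    · by_contra hle
      rw [not_lt] at hle
      lift b to ℝ≥0 using (hle.trans_lt ENNReal.coe_lt_top).ne
      refine hIS b (hI.out ht ht' ⟨?_, ?_⟩) (by simp)
      · exact_mod_cast htb.le
      · exact_mod_cast hle
  have hone : ∀ x, P {x} := by
    refine fun x => ⟨{x.toNNReal}, fun I _ _ hIS ⟨t, ht, htx⟩ => ?_⟩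
    rw [mem_singleton_iff] at htx
    exact absurd (by simp [← htx]) (hIS t ht)
  obtain ⟨S, hS⟩ : P (Iic (Γ.len e)) := by
    refine isClosed_Iic.isCompact.induction_on hempty hmono hunion fun x hx => ?_
    have hleft : ∃ U ∈ 𝓝 x, P (U ∩ Iio x) := by
      rcases eq_or_ne x 0 with rfl | h0
      · exact ⟨univ, univ_mem, by simpa using hempty⟩
      · obtain ⟨n, c, H⟩ := hl e x hx
        obtain ⟨a, ha, hsub⟩ := (mem_nhdsLT_iff_exists_Ioo_subset' (pos_iff_ne_zero.2 h0)).1 H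
        have ha' : a < x := ha
        exact ⟨Ioi a, Ioi_mem_nhds ha', by
          rw [Ioi_inter_Iio]
          exact hIoo (ha'.trans_le le_top).ne ⟨n, c, hsub⟩⟩
    have hright : ∃ U ∈ 𝓝[Iic (Γ.len e)] x, P (U ∩ Ioi x) := by
      rcases eq_or_lt_of_le (mem_Iic.1 hx) with rfl | hlt
      · refine ⟨Iic (Γ.len e), self_mem_nhdsWithin, ?_⟩
        rwa [Iic_inter_Ioi, Ioc_self]
      · obtain ⟨n, c, H⟩ := hr e x hlt
        obtain ⟨b, hb, hsub⟩ := (mem_nhdsGT_iff_exists_Ioo_subset' hlt).1 H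
        refine ⟨Iio b, mem_nhdsWithin_of_mem_nhds (Iio_mem_nhds hb), ?_⟩
        rw [inter_comm, Ioi_inter_Iio]
        exact hIoo (hlt.trans_le le_top).ne ⟨n, c, hsub⟩
    obtain ⟨U, hU, hPU⟩ := hleft
    obtain ⟨U', hU', hPU'⟩ := hright
    refine ⟨U ∩ U', inter_mem (mem_nhdsWithin_of_mem_nhds hU) hU',
      hmono _ _ ?_ (hunion _ _ (hunion _ _ hPU hPU') (hone x))⟩
    intro u hu
    rcases lt_trichotomy u x with h | h | h
    · exact Or.inl (Or.inl ⟨hu.1, h⟩)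
    · exact Or.inr h
    · exact Or.inl (Or.inr ⟨hu.2, h⟩)
  refine ⟨S, fun I hI hIe hIS => ?_⟩
  rcases I.eq_empty_or_nonempty with rfl | ⟨t, ht⟩
  · exact ⟨0, 0, fun t ht => ht.elim⟩
  · exact hS I hI hIe hIS ⟨t, ht, hIe t ht⟩

/-! ### The topology of the curve -/

theorem isCompact_edgeSet (e : Γ.E) : IsCompact (Γ.edgeSet e) :=
  isClosed_Iic.isCompact.image_of_continuousOn (Γ.continuousOn_edge e)

theorem compactSpace (Γ : TropicalCurve X) : CompactSpace X := by
  have h : (⋃ e, Γ.edgeSet e) ∪ range Γ.point = univ := by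
    refine eq_univ_of_forall fun x => ?_
    rcases Γ.cover x with ⟨v, rfl⟩ | ⟨e, s, hs, rfl⟩
    · exact Or.inr ⟨v, rfl⟩
    · exact Or.inl (mem_iUnion.2 ⟨e, s, hs.2.le, rfl⟩)
  refine ⟨?_⟩
  rw [← h]
  exact (isCompact_iUnion fun e => isCompact_edgeSet e).union (finite_range _).isCompact

/-- The curve is a finite union of vertices and images of compact intervals, and images of closed
subsets of these intervals are compact, hence closed in a Hausdorff space. -/
theorem continuous_of_edge [T2Space X] {Z : Type*} [TopologicalSpace Z] {f : X → Z}
    (hf : ∀ e, ContinuousOn (fun t => f (Γ.edge e t)) (Iic (Γ.len e))) : Continuous f := by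
  refine continuous_iff_isClosed.2 fun C hC => ?_
  have h : f ⁻¹' C = (⋃ e, Γ.edge e '' (Iic (Γ.len e) ∩ (fun t => f (Γ.edge e t)) ⁻¹' C)) ∪
      Γ.point '' {v | f (Γ.point v) ∈ C} := by
    ext x
    constructor
    · intro hx
      rcases Γ.cover x with ⟨v, rfl⟩ | ⟨e, s, hs, rfl⟩
      · exact Or.inr ⟨v, hx, rfl⟩
      · exact Or.inl (mem_iUnion.2 ⟨e, s, ⟨hs.2.le, hx⟩, rfl⟩)
    · rintro (hx | ⟨v, hv, rfl⟩)
      · obtain ⟨e, s, hs, rfl⟩ := mem_iUnion.1 hx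
        exact hs.2
      · exact hv
  rw [h]
  refine (isClosed_iUnion_of_finite fun e => ?_).union (Set.toFinite _).isClosed
  have h1 : IsClosed (Iic (Γ.len e) ∩ (fun t => f (Γ.edge e t)) ⁻¹' C) :=
    (hf e).preimage_isClosed_of_isClosed isClosed_Iic hC
  exact (h1.isCompact.image_of_continuousOn
    ((Γ.continuousOn_edge e).mono inter_subset_left)).isClosed

/-! ### The distance from a finite point is a rational function -/

theorem dist_tgt_eq_top {x : X} (hx : x ∈ Γ.finitePoints) {e : Γ.E} (he : Γ.len e = ⊤) :
    Γ.dist x (Γ.point (Γ.tgt e)) = ⊤ := by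
  rw [Γ.dist_comm]
  refine Γ.dist_eq_top_of_infinite (Γ.point_tgt_mem_infinitePoints he) ?_
  rintro rfl
  exact hx (Γ.point_tgt_mem_infinitePoints he)

/-- On each edge, the distance from a finite point is continuous and has affine germs. -/
theorem dist_edge_regular {x : X} (hx : x ∈ Γ.finitePoints) (e : Γ.E) :
    ContinuousOn (fun t => Γ.dist x (Γ.edge e t)) (Iic (Γ.len e)) ∧
      ∀ l, OneSided l → (∀ᶠ u in l, u ≤ Γ.len e) →
        GermAffine l fun u => ((Γ.dist x (Γ.edge e u) : ℝ≥0∞) : EReal) := by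
  have ha : Γ.dist x (Γ.point (Γ.src e)) ≠ ⊤ := Γ.dist_ne_top hx (Γ.point_src_mem_finitePoints e)
  set h : ℝ≥0∞ → ℝ≥0∞ := fun t => min (Γ.dist x (Γ.point (Γ.src e)) + t)
    (Γ.dist x (Γ.point (Γ.tgt e)) + (Γ.len e - t)) with hdef
  have hcoe : ∀ a b : ℝ≥0∞, ((min a b : ℝ≥0∞) : EReal) = min (a : EReal) (b : EReal) :=
    fun a b => EReal.coe_ennreal_strictMono.monotone.map_min
  have hh : ContinuousOn h (Iic (Γ.len e)) ∧ ∀ l, OneSided l → (∀ᶠ u in l, u ≤ Γ.len e) →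
        GermAffine l fun u => ((h u : ℝ≥0∞) : EReal) := by
    by_cases he : Γ.len e = ⊤
    -- The target is infinitely far from `x`, so the route through it drops out of the minimum.
    · have h1 : h = fun t => Γ.dist x (Γ.point (Γ.src e)) + t := by
        funext t
        rw [hdef, dist_tgt_eq_top hx he]
        simp
      rw [h1]
      exact ⟨(continuous_const.add continuous_id).continuousOn,
        fun l hl _ => germAffine_const_add hl ha⟩
    · refine ⟨((continuous_const.add continuous_id).min
        (continuous_const.add (ENNReal.continuous_sub_left he))).continuousOn, fun l hl hle => ?_⟩
      simp only [hdef, hcoe]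
      exact (germAffine_const_add hl ha).min hl (germAffine_add_sub hl
        (Γ.dist_ne_top hx (Γ.point_tgt_mem_finitePoints he)) he hle)
  by_cases hs : ∃ s ∈ Ioo 0 (Γ.len e), Γ.edge e s = x
  · obtain ⟨s, hs, rfl⟩ := hs
    have hs' : s ≠ ⊤ := (hs.2.trans_le le_top).ne
    have heq : EqOn (fun t => Γ.dist (Γ.edge e s) (Γ.edge e t)) (fun t => min (h t) (gap s t))
        (Iic (Γ.len e)) := fun t ht => Γ.dist_edge_of_interior hs ht
    refine ⟨(ContinuousOn.inf hh.1 (continuous_gap_right hs').continuousOn).congr heq, fun l hl hle => ?_⟩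
    refine ((hh.2 l hl hle).min hl (germAffine_gap hl hs')).congr (hle.mono fun u hu => ?_)
    rw [← hcoe]
    exact congrArg _ (heq hu)
  · push Not at hs
    have heq : EqOn (fun t => Γ.dist x (Γ.edge e t)) h (Iic (Γ.len e)) :=
      fun t ht => Γ.dist_edge_of_forall_ne hs ht
    refine ⟨hh.1.congr heq, fun l hl hle => (hh.2 l hl hle).congr (hle.mono fun u hu => ?_)⟩
    exact congrArg _ (heq hu)

theorem continuous_dist [T2Space X] {x : X} (hx : x ∈ Γ.finitePoints) : Continuous (Γ.dist x) :=
  continuous_of_edge fun e => (dist_edge_regular hx e).1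

theorem eventually_le_of_nhdsLT {t L : ℝ≥0∞} (h : t ≤ L) : ∀ᶠ u in 𝓝[<] t, u ≤ L :=
  eventually_mem_nhdsWithin.mono fun _ hu => (le_of_lt hu).trans h

theorem eventually_le_of_nhdsGT {t L : ℝ≥0∞} (h : t < L) : ∀ᶠ u in 𝓝[>] t, u ≤ L :=
  mem_nhdsWithin_of_mem_nhds (mem_of_superset (Iio_mem_nhds h) fun u (hu : u < L) => hu.le)

variable (Γ) in
/-- The distance from a finite point, as a rational function. -/
def distFun [T2Space X] (x : X) (hx : x ∈ Γ.finitePoints) : Γ.RatFun :=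
  ⟨fun y => ((Γ.dist x y : ℝ≥0∞) : EReal), by
    refine ⟨continuous_coe_ennreal_ereal.comp (continuous_dist hx), Or.inr ⟨?_, fun y hy =>
      ⟨EReal.coe_ennreal_ne_bot _, fun h => Γ.dist_ne_top hx hy (EReal.coe_ennreal_eq_top_iff.1 h)⟩⟩⟩
    exact isPiecewiseAffine_of_germAffine
      (fun e t ht => (dist_edge_regular hx e).2 _ (oneSided_nhdsLT t) (eventually_le_of_nhdsLT ht))
      (fun e t ht => (dist_edge_regular hx e).2 _ (oneSided_nhdsGT t) (eventually_le_of_nhdsGT ht))⟩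

theorem distFun_apply [T2Space X] (x : X) (hx : x ∈ Γ.finitePoints) (y : X) :
    Γ.distFun x hx y = ((Γ.dist x y : ℝ≥0∞) : EReal) := rfl

end TropicalCurve

/-- If the germ of `g` at one side of `s` is affine, then its value at `s` is the limit. -/
theorem eq_of_tendsto_of_germAffine {l : Filter ℝ≥0∞} [l.NeBot] {s : ℝ≥0∞} (hs : s ≠ ⊤)
    (hl : l ≤ 𝓝 s) {g : ℝ≥0∞ → EReal} (hg : Tendsto g l (𝓝 (g s))) {n : ℤ} {c : ℝ}
    (h : ∀ᶠ u in l, g u = ((n * u.toReal + c : ℝ) : EReal)) :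
    g s = ((n * s.toReal + c : ℝ) : EReal) := by
  refine tendsto_nhds_unique_of_eventuallyEq hg ?_ h
  refine (continuous_coe_real_ereal.tendsto _).comp ?_
  exact (((ENNReal.tendsto_toReal hs).mono_left hl).const_mul _).add_const _

/-- A continuous function on an interval that differs from a constant by integral multiples of the
distance from a point outside is affine. -/
theorem exists_forall_eq_add_int_mul {J : Set ℝ≥0∞} (hJ : IsPreconnected J) (htop : ∀ u ∈ J, u ≠ ⊤)
    {g : ℝ≥0∞ → EReal} (hg : ContinuousOn g J) {y₀ t₀ : ℝ} (hne : ∀ u ∈ J, u.toReal ≠ t₀)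
    (h : ∀ u ∈ J, ∃ n : ℤ, g u = ((y₀ + n * (u.toReal - t₀) : ℝ) : EReal)) :
    ∃ n : ℤ, ∀ u ∈ J, g u = ((y₀ + n * (u.toReal - t₀) : ℝ) : EReal) := by
  rcases J.eq_empty_or_nonempty with rfl | ⟨u₀, hu₀⟩
  · exact ⟨0, fun u hu => hu.elim⟩
  obtain ⟨n, hn⟩ := h u₀ hu₀
  refine ⟨n, fun u hu => ?_⟩
  -- The integer is recovered as a difference quotient. This quotient is continuous with values in
  -- the discrete set of integers, so it is constant on the preconnected set `J`.
  have key : ∀ v ∈ J, ∀ m : ℤ, g v = ((y₀ + m * (v.toReal - t₀) : ℝ) : EReal) →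
      ((g v).toReal - y₀) / (v.toReal - t₀) = m := by
    intro v hv m hm
    rw [hm, EReal.toReal_coe, add_sub_cancel_left, mul_div_cancel_right₀]
    exact sub_ne_zero.2 (hne v hv)
  have hc : ContinuousOn (fun v => ((g v).toReal - y₀) / (v.toReal - t₀)) J := by
    refine ContinuousOn.div (ContinuousOn.sub ?_ continuousOn_const)
      (ContinuousOn.sub (ENNReal.continuousOn_toReal.mono htop) continuousOn_const)
      fun v hv => sub_ne_zero.2 (hne v hv)
    refine EReal.continuousOn_toReal.comp hg fun v hv => ?_
    obtain ⟨m, hm⟩ := h v hv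
    rw [hm]
    exact fun h => h.elim (EReal.coe_ne_bot _) (EReal.coe_ne_top _)
  have hT : MapsTo (fun v => ((g v).toReal - y₀) / (v.toReal - t₀)) J
      (range ((↑) : ℤ → ℝ)) := by
    intro v hv
    obtain ⟨m, hm⟩ := h v hv
    exact ⟨m, (key v hv m hm).symm⟩
  have : DiscreteTopology (range ((↑) : ℤ → ℝ)) :=
    Int.isClosedEmbedding_coe_real.isEmbedding.toHomeomorph.discreteTopology
  obtain ⟨m, hm⟩ := h u hu
  have heq := hJ.constant_of_mapsTo ⟨this⟩ hc hT hu hu₀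
  rw [key u hu m hm, key u₀ hu₀ n hn] at heq
  rw [hm, Int.cast_injective heq]

namespace TropicalCurve

variable {X : Type*} [TopologicalSpace X] (Γ : TropicalCurve X)

/-! ### Piecewise affine functions in terms of the distance -/

/-- Near `y`, the function `f` differs from `f y` by integral multiples of the distance from `y`,
with bounded factors. -/
def IsLocallyAffineAt (f : X → EReal) (y : X) : Prop :=
  ∀ᶠ k : ℕ in atTop, ∀ z, Γ.dist y z < (k : ℝ≥0∞)⁻¹ →
    ∃ n : ℤ, |n| ≤ k ∧ f z = f y + ((n * (Γ.dist y z).toReal : ℝ) : EReal)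

/-- Near the point at infinity `y`, the function `f` is an affine function of the distance from a
finite point. -/
def IsAffineAtInfinity (f : X → EReal) (y : X) : Prop :=
  ∃ x ∈ Γ.finitePoints, ∃ (n : ℤ) (c : ℝ), ∀ᶠ z in 𝓝[Γ.finitePoints] y,
    f z = ((n * (Γ.dist x z).toReal + c : ℝ) : EReal)

variable {Γ}

theorem tendsto_edge {e : Γ.E} {s : ℝ≥0∞} (hs : s ≤ Γ.len e) {l : Filter ℝ≥0∞} (hl : l ≤ 𝓝 s)
    (hle : ∀ᶠ u in l, u ≤ Γ.len e) : Tendsto (Γ.edge e) l (𝓝 (Γ.edge e s)) :=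
  (Γ.continuousOn_edge e s hs).mono_left (le_inf hl (le_principal_iff.2 hle))

/-- The point `y` has finitely many parameters on each edge, each with at most two one-sided slopes.
The number `k` has two roles, inverse radius and bound for the slopes; any large `k` serves both for
all these germs at once. -/
theorem IsPiecewiseAffine.isLocallyAffineAt {f : X → EReal} (hf : Γ.IsPiecewiseAffine f)
    (hc : Continuous f) {y : X} (hy : y ∈ Γ.finitePoints) : Γ.IsLocallyAffineAt f y := by
  have hedge : ∀ e, ∀ s ∈ {s | s ≤ Γ.len e ∧ Γ.edge e s = y}, ∀ᶠ k : ℕ in atTop, ∀ u ≤ Γ.len e,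
      gap s u < (k : ℝ≥0∞)⁻¹ →
        ∃ n : ℤ, |n| ≤ k ∧ f (Γ.edge e u) = f y + ((n * (gap s u).toReal : ℝ) : EReal) := by
    rintro e s ⟨hs, rfl⟩
    have hs' := Γ.ne_top_of_edge_mem_finitePoints hs hy
    have hleft : ∃ n : ℤ, ∀ᶠ u in 𝓝 s, u < s →
        f (Γ.edge e u) = f (Γ.edge e s) + ((n * (gap s u).toReal : ℝ) : EReal) := by
      rcases eq_or_ne s 0 with rfl | h0
      · exact ⟨0, Eventually.of_forall fun u hu => absurd hu not_lt_zero⟩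
      · obtain ⟨n, c, h⟩ := hf.germAffine_nhdsLT e hs
        have : (𝓝[<] s).NeBot := nhdsLT_neBot_of_exists_lt ⟨0, pos_iff_ne_zero.2 h0⟩
        have h1 := eq_of_tendsto_of_germAffine hs' nhdsWithin_le_nhds
          ((hc.tendsto _).comp (tendsto_edge hs nhdsWithin_le_nhds (eventually_le_of_nhdsLT hs))) h
        refine ⟨-n, (eventually_nhdsWithin_iff.1 h).mono fun u hu hlt => ?_⟩
        change f (Γ.edge e s) = _ at h1
        refine (hu hlt).trans ?_
        rw [h1, ← EReal.coe_add, toReal_gap_of_ge (le_of_lt hlt) hs']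
        congr 1
        push_cast
        ring
    have hright : ∃ n : ℤ, ∀ᶠ u in 𝓝 s, u ≤ Γ.len e → s < u →
        f (Γ.edge e u) = f (Γ.edge e s) + ((n * (gap s u).toReal : ℝ) : EReal) := by
      rcases eq_or_lt_of_le hs with rfl | hlt
      · exact ⟨0, Eventually.of_forall fun u hu hu' => absurd hu (not_le.2 hu')⟩
      · obtain ⟨n, c, h⟩ := hf.germAffine_nhdsGT e hlt
        have : (𝓝[>] s).NeBot := nhdsGT_neBot_of_exists_gt ⟨_, hlt⟩
        have h1 := eq_of_tendsto_of_germAffine hs' nhdsWithin_le_nhds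
          ((hc.tendsto _).comp (tendsto_edge hs nhdsWithin_le_nhds (eventually_le_of_nhdsGT hlt))) h
        refine ⟨n, ?_⟩
        filter_upwards [eventually_nhdsWithin_iff.1 h, Iio_mem_nhds hs'.lt_top] with u hu hu' _ hlt
        change f (Γ.edge e s) = _ at h1
        refine (hu hlt).trans ?_
        rw [h1, ← EReal.coe_add, toReal_gap_of_le (le_of_lt hlt) (ne_of_lt hu')]
        congr 1
        ring
    obtain ⟨n, hn⟩ := hleft
    obtain ⟨m, hm⟩ := hright
    filter_upwards [eventually_forall_gap_lt hs' (hn.and hm),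
      eventually_ge_atTop (n.natAbs + m.natAbs)] with k hk hkn u hu hgap
    obtain ⟨h1, h2⟩ := hk u hgap
    rcases lt_trichotomy u s with h | rfl | h
    · exact ⟨n, by rw [Int.abs_eq_natAbs]; omega, h1 h⟩
    · exact ⟨0, by simp, by simp⟩
    · exact ⟨m, by rw [Int.abs_eq_natAbs]; omega, h2 hu h⟩
  have hall : ∀ᶠ k : ℕ in atTop, ∀ e, ∀ s ∈ {s | s ≤ Γ.len e ∧ Γ.edge e s = y}, ∀ u ≤ Γ.len e,
      gap s u < (k : ℝ≥0∞)⁻¹ →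
        ∃ n : ℤ, |n| ≤ k ∧ f (Γ.edge e u) = f y + ((n * (gap s u).toReal : ℝ) : EReal) :=
    eventually_all.2 fun e => (eventually_all_finite (Γ.finite_edge_fiber e y)).2 (hedge e)
  obtain ⟨ε, hε⟩ := Γ.exists_isLocalScale y
  filter_upwards [hall, ENNReal.tendsto_inv_nat_nhds_zero.eventually (gt_mem_nhds hε.pos)]
    with k hk hkε z hz
  rcases hε.exists_edge (hz.trans hkε) with rfl | ⟨e, s, t, hs, ht, hy', rfl, hd⟩
  · exact ⟨0, by simp, by simp⟩
  · rw [hd] at hz ⊢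
    exact hk e s ⟨hs, hy'⟩ t ht hz

/-- On a leaf edge of infinite length the parameter is the distance from the source, because the
route through the other end is infinitely long. So the source serves as the reference point. -/
theorem IsPiecewiseAffine.isAffineAtInfinity [T2Space X] {f : X → EReal}
    (hf : Γ.IsPiecewiseAffine f) {y : X} (hy : y ∈ Γ.infinitePoints) :
    Γ.IsAffineAtInfinity f y := by
  obtain ⟨e, he, rfl⟩ := hy
  obtain ⟨n, c, h⟩ := hf.germAffine_nhdsLT e (t := ⊤) he.ge
  refine ⟨_, Γ.point_src_mem_finitePoints e, n, c, Γ.nhdsWithin_top_le he ?_⟩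
  have ht : Tendsto (fun t : ℝ≥0 => (t : ℝ≥0∞)) atTop (𝓝[<] ⊤) :=
    tendsto_nhdsWithin_iff.2 ⟨ENNReal.tendsto_coe_nhds_top.2 tendsto_id,
      Eventually.of_forall fun t => ENNReal.coe_lt_top⟩
  refine mem_map.2 ((ht.eventually h).mono fun t ht => ?_)
  have hd : Γ.dist (Γ.point (Γ.src e)) (Γ.edge e t) = t := by
    rw [Γ.dist_edge_of_forall_ne (fun s hs => Γ.edge_ne_point e s hs _) (by rw [he]; exact le_top),
      dist_tgt_eq_top (Γ.point_src_mem_finitePoints e) he, Γ.dist_self]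
    simp
  refine Eq.trans ht ?_
  change _ = ((n * (Γ.dist (Γ.point (Γ.src e)) (Γ.edge e t)).toReal + c : ℝ) : EReal)
  rw [hd]

/-- The integers in the local condition may vary from point to point, but by
`exists_forall_eq_add_int_mul` they are constant on each side of a parameter. At `∞` the function is
affine in a distance that is itself an affine germ on the edge, and the slopes multiply. -/
theorem isPiecewiseAffine_of_local [T2Space X] {f : X → EReal} (hc : Continuous f)
    (hfin : ∀ y ∈ Γ.finitePoints, f y ≠ ⊥ ∧ f y ≠ ⊤)
    (hloc : ∀ y ∈ Γ.finitePoints, Γ.IsLocallyAffineAt f y)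
    (hinf : ∀ y ∈ Γ.infinitePoints, Γ.IsAffineAtInfinity f y) : Γ.IsPiecewiseAffine f := by
  have key : ∀ e, ∀ s ≤ Γ.len e, s ≠ ⊤ → ∃ δ, 0 < δ ∧ ∀ u ≤ Γ.len e, gap s u < δ → ∃ n : ℤ,
      f (Γ.edge e u) =
        (((f (Γ.edge e s)).toReal + n * (gap s u).toReal : ℝ) : EReal) := by
    intro e s hs hs'
    have hy := Γ.edge_mem_finitePoints hs hs'
    obtain ⟨ε, hε⟩ := Γ.exists_isLocalScale (Γ.edge e s)
    obtain ⟨k, hk⟩ := (hloc _ hy).exists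
    refine ⟨min ε (k : ℝ≥0∞)⁻¹, lt_min hε.pos (by simp), fun u hu hgap => ?_⟩
    have hd := hε.dist_edge hs hu rfl (hgap.trans_le (min_le_left _ _))
    obtain ⟨n, -, hn⟩ := hk (Γ.edge e u) (by rw [hd]; exact hgap.trans_le (min_le_right _ _))
    refine ⟨n, ?_⟩
    rw [hn, hd, EReal.coe_add, EReal.coe_toReal (hfin _ hy).2 (hfin _ hy).1]
  have hcont : ∀ e, ContinuousOn (fun u => f (Γ.edge e u)) (Iic (Γ.len e)) :=
    fun e => hc.comp_continuousOn (Γ.continuousOn_edge e)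
  refine isPiecewiseAffine_of_germAffine (fun e t ht => ?_) fun e t ht => ?_
  · rcases eq_or_ne t ⊤ with rfl | htop
    · have he := top_le_iff.1 ht
      obtain ⟨x, hx, n, c, h⟩ := hinf _ ⟨e, he, rfl⟩
      obtain ⟨m, d, h'⟩ := (dist_edge_regular hx e).2 _ (oneSided_nhdsLT ⊤)
        (eventually_le_of_nhdsLT ht)
      have hmem : ∀ᶠ u in 𝓝[<] (⊤ : ℝ≥0∞), Γ.edge e u ∈ Γ.finitePoints := by
        filter_upwards [eventually_mem_nhdsWithin] with u hu
        exact Γ.edge_mem_finitePoints (he ▸ le_top) (ne_of_lt hu)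
      have ht' : Tendsto (Γ.edge e) (𝓝[<] ⊤) (𝓝[Γ.finitePoints] (Γ.edge e ⊤)) :=
        tendsto_nhdsWithin_iff.2 ⟨tendsto_edge ht nhdsWithin_le_nhds (eventually_le_of_nhdsLT ht),
          hmem⟩
      refine ⟨n * m, n * d + c, ?_⟩
      filter_upwards [ht'.eventually h, h', hmem] with u h1 h2 h3
      rw [EReal.coe_ennreal_eq_coe_toReal (Γ.dist_ne_top hx h3), EReal.coe_eq_coe_iff] at h2
      rw [h1, h2]
      congr 1
      push_cast
      ring
    · rcases eq_or_ne t 0 with rfl | h0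
      · exact ⟨0, 0, by simp⟩
      obtain ⟨δ, hδ, h⟩ := key e t ht htop
      have hlt : t - δ < t := ENNReal.sub_lt_self htop h0 hδ.ne'
      obtain ⟨n, hn⟩ := exists_forall_eq_add_int_mul (J := Ioo (t - δ) t) isPreconnected_Ioo
        (fun u hu => (hu.2.trans_le le_top).ne) (g := fun u => f (Γ.edge e u))
        ((hcont e).mono fun u hu => hu.2.le.trans ht) (y₀ := (f (Γ.edge e t)).toReal)
        (t₀ := t.toReal) (fun u hu =>
          ((ENNReal.toReal_lt_toReal (hu.2.trans_le le_top).ne htop).2 hu.2).ne) fun u hu => by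
          obtain ⟨n, hn⟩ := h u (hu.2.le.trans ht) (by
            rw [gap_of_ge hu.2.le]
            refine ENNReal.sub_lt_of_lt_add hu.2.le (not_le.1 fun hle => not_le.2 hu.1 ?_)
            exact ENNReal.le_sub_of_add_le_left
              ((le_self_add.trans hle).trans_lt htop.lt_top).ne hle)
          refine ⟨-n, ?_⟩
          rw [hn, toReal_gap_of_ge hu.2.le htop]
          congr 1
          push_cast
          ring
      refine ⟨n, (f (Γ.edge e t)).toReal - n * t.toReal, ?_⟩
      filter_upwards [Ioo_mem_nhdsLT hlt] with u hu
      refine (hn u hu).trans ?_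
      congr 1
      ring
  · have htop : t ≠ ⊤ := (ht.trans_le le_top).ne
    obtain ⟨δ, hδ, h⟩ := key e t ht.le htop
    have hlt : t < min (t + δ) (Γ.len e) :=
      lt_min (ENNReal.lt_add_right htop hδ.ne') ht
    have hle : ∀ u ∈ Ioo t (min (t + δ) (Γ.len e)), u ≤ Γ.len e :=
      fun u hu => (hu.2.trans_le (min_le_right _ _)).le
    obtain ⟨n, hn⟩ := exists_forall_eq_add_int_mul (J := Ioo t (min (t + δ) (Γ.len e)))
      isPreconnected_Ioo
      (fun u hu => (hu.2.trans_le le_top).ne) (g := fun u => f (Γ.edge e u))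
      ((hcont e).mono hle) (y₀ := (f (Γ.edge e t)).toReal)
      (t₀ := t.toReal) (fun u hu =>
        ((ENNReal.toReal_lt_toReal htop (hu.2.trans_le le_top).ne).2 hu.1).ne') fun u hu => by
        obtain ⟨n, hn⟩ := h u (hle u hu) (by
          rw [gap_of_le hu.1.le]
          exact ENNReal.sub_lt_of_lt_add hu.1.le
            (by rw [add_comm]; exact hu.2.trans_le (min_le_left _ _)))
        refine ⟨n, ?_⟩
        rw [hn, toReal_gap_of_le hu.1.le (hu.2.trans_le le_top).ne]
    refine ⟨n, (f (Γ.edge e t)).toReal - n * t.toReal, ?_⟩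
    filter_upwards [Ioo_mem_nhdsGT hlt] with u hu
    refine (hn u hu).trans ?_
    congr 1
    ring

/-- Rational functions, characterized by the distance and the topology alone. -/
theorem isRational_iff [T2Space X] {f : X → EReal} :
    Γ.IsRational f ↔ Continuous f ∧ ((∀ x, f x = ⊥) ∨
      ((∀ y ∈ Γ.finitePoints, f y ≠ ⊥ ∧ f y ≠ ⊤) ∧ (∀ y ∈ Γ.finitePoints, Γ.IsLocallyAffineAt f y) ∧
        ∀ y ∈ Γ.infinitePoints, Γ.IsAffineAtInfinity f y)) := by
  constructor
  · rintro ⟨hc, h | ⟨hpa, hfin⟩⟩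
    · exact ⟨hc, Or.inl h⟩
    · exact ⟨hc, Or.inr ⟨hfin, fun y hy => hpa.isLocallyAffineAt hc hy,
        fun y hy => hpa.isAffineAtInfinity hy⟩⟩
  · rintro ⟨hc, h | ⟨hfin, hloc, hinf⟩⟩
    · exact ⟨hc, Or.inl h⟩
    · exact ⟨hc, Or.inr ⟨isPiecewiseAffine_of_local hc hfin hloc hinf, hfin⟩⟩

/-! ### Isometries -/

variable (Γ) in
/-- A homeomorphism of the curve that preserves the distance. -/
structure IsIsometry (σ : Equiv.Perm X) : Prop where
  continuous : Continuous σ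
  dist_map : ∀ x y, Γ.dist (σ x) (σ y) = Γ.dist x y

namespace IsIsometry

variable {σ τ : Equiv.Perm X}

theorem one : Γ.IsIsometry 1 := ⟨continuous_id, fun _ _ => rfl⟩

theorem mul (hσ : Γ.IsIsometry σ) (hτ : Γ.IsIsometry τ) : Γ.IsIsometry (σ * τ) :=
  ⟨hσ.continuous.comp hτ.continuous, fun x y => (hσ.dist_map _ _).trans (hτ.dist_map x y)⟩

theorem inv [T2Space X] (hσ : Γ.IsIsometry σ) : Γ.IsIsometry σ⁻¹ := by
  have := Γ.compactSpace
  refine ⟨?_, fun x y => ?_⟩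
  · exact Continuous.continuous_symm_of_equiv_compact_to_t2 (f := σ) hσ.continuous
  · rw [← hσ.dist_map]
    simp

theorem mem_infinitePoints (hσ : Γ.IsIsometry σ) {x : X} :
    σ x ∈ Γ.infinitePoints ↔ x ∈ Γ.infinitePoints := by
  simp only [Γ.mem_infinitePoints_iff]
  refine and_congr ⟨?_, ?_⟩ ⟨?_, ?_⟩
  · rintro ⟨y, hy⟩
    exact ⟨σ.symm y, fun h => hy (by simp [← h])⟩
  · rintro ⟨y, hy⟩
    exact ⟨σ y, fun h => hy (σ.injective h)⟩
  · intro h y hy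
    rw [← hσ.dist_map]
    exact h _ fun h' => hy (σ.injective h')
  · intro h y hy
    have := h (σ.symm y) fun h' => hy (by simp [← h'])
    rwa [← hσ.dist_map, Equiv.apply_symm_apply] at this

theorem mem_finitePoints (hσ : Γ.IsIsometry σ) {x : X} :
    σ x ∈ Γ.finitePoints ↔ x ∈ Γ.finitePoints := not_congr hσ.mem_infinitePoints

/-- An isometry need not respect the vertices and edges of `Γ`. The criterion `isRational_iff`
avoids them: it refers to the topology, the distance and the points at infinity, all of which `σ`
preserves. -/
theorem isRational_comp [T2Space X] (hσ : Γ.IsIsometry σ) {f : X → EReal} (hf : Γ.IsRational f) :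
    Γ.IsRational fun x => f (σ x) := by
  rw [isRational_iff] at hf ⊢
  obtain ⟨hc, hf⟩ := hf
  refine ⟨hc.comp hσ.continuous, hf.imp (fun h x => h _) ?_⟩
  rintro ⟨hfin, hloc, hinf⟩
  refine ⟨fun y hy => hfin _ (hσ.mem_finitePoints.2 hy), fun y hy => ?_, fun y hy => ?_⟩
  · refine (hloc _ (hσ.mem_finitePoints.2 hy)).mono fun k hk z hz => ?_
    rw [← hσ.dist_map] at hz ⊢
    exact hk _ hz
  · obtain ⟨x, hx, n, c, h⟩ := hinf _ (hσ.mem_infinitePoints.2 hy)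
    refine ⟨σ⁻¹ x, hσ.inv.mem_finitePoints.2 hx, n, c, ?_⟩
    have ht : Tendsto σ (𝓝[Γ.finitePoints] y) (𝓝[Γ.finitePoints] (σ y)) :=
      hσ.continuous.continuousWithinAt.tendsto_nhdsWithin fun z hz => hσ.mem_finitePoints.2 hz
    filter_upwards [ht.eventually h] with z hz
    rw [hz, ← hσ.dist_map (σ⁻¹ x)]
    simp

end IsIsometry

end TropicalCurve

namespace TropicalCurve

variable {X : Type*} [TopologicalSpace X] {Γ : TropicalCurve X}

/-! ### Calculations in the semiring of rational functions -/

namespace RatFun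

theorem ext_apply {f g : Γ.RatFun} (h : ∀ x, f x = g x) : f = g := Subtype.ext (funext h)

theorem add_apply (f g : Γ.RatFun) (x : X) : (f + g) x = max (f x) (g x) := rfl

theorem zero_apply (x : X) : (0 : Γ.RatFun) x = ⊥ := rfl

theorem one_apply (x : X) : (1 : Γ.RatFun) x = 0 := rfl

theorem mul_apply [T2Space X] (f g : Γ.RatFun) {x : X} (hx : x ∈ Γ.finitePoints) :
    (f * g) x = f x + g x := prod_apply f g hx

theorem finite_of_ne_zero {f : Γ.RatFun} (hf : f ≠ 0) {x : X} (hx : x ∈ Γ.finitePoints) :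
    f x ≠ ⊥ ∧ f x ≠ ⊤ := by
  rcases f.2.eq_bot_or with h | h
  · exact absurd (ext_apply h) hf
  · exact h.2 x hx

/-- The constant rational function with a real value. -/
def realConst (Γ : TropicalCurve X) (c : ℝ) : Γ.RatFun := const Γ (show WithBot ℝ from (c : ℝ))

theorem tendsto_edge_top {e : Γ.E} (he : Γ.len e = ⊤) :
    Tendsto (fun t : ℝ≥0 => Γ.edge e t) atTop (𝓝 (Γ.edge e ⊤)) :=
  (tendsto_edge he.ge le_rfl (Eventually.of_forall fun _ => he ▸ le_top)).comp
    (ENNReal.tendsto_coe_nhds_top.2 tendsto_id)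

theorem apply_top_eq (f : Γ.RatFun) {e : Γ.E} (he : Γ.len e = ⊤) {c : EReal}
    (h : ∀ t : ℝ≥0, 1 < t → f (Γ.edge e t) = c) : f (Γ.edge e ⊤) = c :=
  tendsto_nhds_unique_of_eventuallyEq ((f.2.continuous.tendsto _).comp (tendsto_edge_top he))
    tendsto_const_nhds ((eventually_gt_atTop 1).mono h)

/-- The tropical inverse of a rational function. -/
def neg (f : Γ.RatFun) (hf : f ≠ 0) : Γ.RatFun :=
  ⟨fun x => -f x, f.2.continuous.neg, Or.inr ⟨fun e => by
    obtain ⟨S, hS⟩ := (f.2.eq_bot_or.resolve_left fun h => hf (ext_apply h)).1 e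
    refine ⟨S, fun I hI hIe hIS => ?_⟩
    obtain ⟨n, c, h⟩ := hS I hI hIe hIS
    refine ⟨-n, -c, fun t ht => (congrArg Neg.neg (h t ht)).trans ?_⟩
    rw [← EReal.coe_neg]
    congr 1
    push_cast
    ring, fun x hx => ⟨fun h => (finite_of_ne_zero hf hx).2 (EReal.neg_eq_bot_iff.1 h),
      fun h => (finite_of_ne_zero hf hx).1 (EReal.neg_eq_top_iff.1 h)⟩⟩⟩

theorem neg_apply (f : Γ.RatFun) (hf : f ≠ 0) (x : X) : neg f hf x = -f x := rfl

variable [T2Space X]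

/-- The formula extends from the finite points to all points, since adding a real number is
continuous on `[-∞, ∞]`. -/
theorem realConst_mul_apply (c : ℝ) (f : Γ.RatFun) (x : X) :
    (realConst Γ c * f) x = (c : EReal) + f x := by
  have hc : Continuous fun x => (c : EReal) + f x := by
    refine continuous_iff_continuousAt.2 fun x => ?_
    have h := EReal.continuousAt_add (p := ((c : EReal), f x)) (Or.inl (EReal.coe_ne_top c))
      (Or.inl (EReal.coe_ne_bot c))
    exact h.tendsto.comp ((continuous_const.prodMk f.2.continuous).tendsto x)
  exact congrFun (Continuous.ext_on Γ.dense_finitePoints (realConst Γ c * f).2.continuous hc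
    fun y hy => mul_apply _ _ hy) x

theorem map_realConst (Φ : Γ.RatFun →ₐ[TropicalSemifield] Γ.RatFun) (c : ℝ) :
    Φ (realConst Γ c) = realConst Γ c := Φ.commutes (show WithBot ℝ from (c : ℝ))

theorem exists_mul_eq_one {f : Γ.RatFun} (hf : f ≠ 0) : ∃ g : Γ.RatFun, g * f = 1 := by
  refine ⟨neg f hf, ext_of_finitePoints fun x hx => ?_⟩
  have h := finite_of_ne_zero hf hx
  rw [mul_apply _ _ hx, one_apply, neg_apply, ← EReal.coe_toReal h.2 h.1, ← EReal.coe_neg,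
    ← EReal.coe_add]
  simp

theorem apply_of_mul_eq_one {f g : Γ.RatFun} (h : g * f = 1) (x : X) : g x = -f x := by
  refine congrFun (Continuous.ext_on Γ.dense_finitePoints g.2.continuous f.2.continuous.neg
    fun y hy => ?_) x
  have h1 : g y + f y = 0 := by rw [← mul_apply g f hy, h, one_apply]
  have h0 : f ≠ 0 := by
    rintro rfl
    rw [zero_apply, EReal.add_bot] at h1
    exact EReal.bot_ne_zero h1
  have hf := finite_of_ne_zero h0 hy
  have h0' : g ≠ 0 := by
    rintro rfl
    rw [zero_apply, EReal.bot_add] at h1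
    exact EReal.bot_ne_zero h1
  have hg := finite_of_ne_zero h0' hy
  change g y = -f y
  rw [← EReal.coe_toReal hf.2 hf.1, ← EReal.coe_toReal hg.2 hg.1] at h1 ⊢
  rw [← EReal.coe_add, EReal.coe_eq_zero] at h1
  rw [← EReal.coe_neg, EReal.coe_eq_coe_iff]
  linarith

/-! ### Rational functions separate points -/

/-- Two points at infinity are separated by a difference of two distances. -/
theorem exists_apply_top_ne {e e' : Γ.E} (he : Γ.len e = ⊤) (he' : Γ.len e' = ⊤) (hne : e' ≠ e) :
    ∃ f : Γ.RatFun, f (Γ.edge e ⊤) ≠ f (Γ.edge e' ⊤) := by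
  have hle : ∀ t, t ≤ Γ.len e := fun t => he ▸ le_top
  have hy₁ := Γ.edge_mem_finitePoints (hle 0) ENNReal.zero_ne_top
  have hy₂ := Γ.edge_mem_finitePoints (hle 1) ENNReal.one_ne_top
  have h0 : Γ.distFun _ hy₂ ≠ 0 := fun h => by
    have := congrArg (fun f : Γ.RatFun => f (Γ.edge e 0)) h
    exact EReal.coe_ennreal_ne_bot _ this
  obtain ⟨g, hg⟩ := exists_mul_eq_one h0
  -- The product is the distance from parameter `0` minus the distance from parameter `1` of the
  -- leaf edge `e`. It equals `1` on `e` beyond parameter `1`, and `-1` off the edge, where every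
  -- route to parameter `1` passes parameter `0`.
  have hval : ∀ z ∈ Γ.finitePoints, (Γ.distFun _ hy₁ * g) z =
      (((Γ.dist (Γ.edge e 0) z).toReal - (Γ.dist (Γ.edge e 1) z).toReal : ℝ) : EReal) := by
    intro z hz
    rw [mul_apply _ _ hz, apply_of_mul_eq_one hg, distFun_apply, distFun_apply,
      EReal.coe_ennreal_eq_coe_toReal (Γ.dist_ne_top hy₁ hz),
      EReal.coe_ennreal_eq_coe_toReal (Γ.dist_ne_top hy₂ hz)]
    rfl
  have hsrc : ∀ x ∈ Γ.finitePoints, (∀ s ∈ Ioo 0 (Γ.len e), Γ.edge e s ≠ x) → ∀ t ≠ ⊤,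
      Γ.dist x (Γ.edge e t) = Γ.dist x (Γ.edge e 0) + t := by
    intro x hx h t ht
    rw [Γ.dist_edge_of_forall_ne h (hle t), he, ENNReal.top_sub ht, add_top, min_top_right,
      Γ.edge_zero]
  have h1 : (Γ.distFun _ hy₁ * g) (Γ.edge e ⊤) = ((1 : ℝ) : EReal) := by
    refine apply_top_eq _ he fun t ht => ?_
    rw [hval _ (Γ.edge_mem_finitePoints (hle _) ENNReal.coe_ne_top)]
    congr 1
    have ht' : (1 : ℝ≥0∞) ≤ t := by exact_mod_cast ht.le
    rw [hsrc _ hy₁ (fun s hs h => Γ.edge_ne_point e s hs _ (h.trans (Γ.edge_zero e))) _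
      ENNReal.coe_ne_top, Γ.dist_self, zero_add,
      Γ.dist_edge_of_interior ⟨one_pos, he ▸ ENNReal.one_lt_top⟩ (hle _), he,
      ENNReal.top_sub ENNReal.coe_ne_top, add_top, min_top_right, gap_of_le ht', min_eq_right,
      ENNReal.toReal_sub_of_le ht' ENNReal.coe_ne_top]
    · simp
    · exact tsub_le_self.trans le_add_self
  have h2 : (Γ.distFun _ hy₁ * g) (Γ.edge e' ⊤) = ((-1 : ℝ) : EReal) := by
    refine apply_top_eq _ he' fun t ht => ?_
    have hz := Γ.edge_mem_finitePoints (e := e') (t := t) (he' ▸ le_top) ENNReal.coe_ne_top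
    have ht' : (0 : ℝ≥0∞) < t := by exact_mod_cast one_pos.trans ht
    have hoff : ∀ s ∈ Ioo 0 (Γ.len e), Γ.edge e s ≠ Γ.edge e' t := fun s hs h =>
      hne (Γ.edge_injective _ _ _ _ hs ⟨ht', he' ▸ ENNReal.coe_lt_top⟩ h).1.symm
    rw [hval _ hz]
    congr 1
    rw [Γ.dist_comm (Γ.edge e 1), hsrc _ hz hoff 1 ENNReal.one_ne_top,
      ENNReal.toReal_add (Γ.dist_ne_top hz hy₁) ENNReal.one_ne_top, Γ.dist_comm (Γ.edge e 0)]
    simp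
  refine ⟨Γ.distFun _ hy₁ * g, fun h => ?_⟩
  rw [h1, h2, EReal.coe_eq_coe_iff] at h
  norm_num at h

/-- A finite point is the only zero of its own distance function, which is rational. Only two points
at infinity need `exists_apply_top_ne`. -/
theorem eq_of_forall_apply_eq {x y : X} (h : ∀ f : Γ.RatFun, f x = f y) : x = y := by
  have key : ∀ {x y : X}, (∀ f : Γ.RatFun, f x = f y) → x ∈ Γ.finitePoints → x = y := by
    intro x y h hx
    have h1 := h (Γ.distFun x hx)
    rw [distFun_apply, distFun_apply, Γ.dist_self] at h1
    exact Γ.eq_of_dist_eq_zero (EReal.coe_ennreal_injective h1.symm)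
  by_cases hx : x ∈ Γ.finitePoints
  · exact key h hx
  by_cases hy : y ∈ Γ.finitePoints
  · exact (key (fun f => (h f).symm) hy).symm
  obtain ⟨e, he, rfl⟩ : x ∈ Γ.infinitePoints := not_not.1 hx
  obtain ⟨e', he', rfl⟩ : y ∈ Γ.infinitePoints := not_not.1 hy
  by_contra hne
  obtain ⟨f, hf⟩ := exists_apply_top_ne he he' (by rintro rfl; exact hne rfl)
  exact hf (h f)

/-! ### Endomorphisms of the algebra of rational functions come from maps of the curve -/

/-- If no point represents `f ↦ Φ f x`, then every `x'` has a neighbourhood with a rational function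
that is positive there although its image is negative at `x`. The maximum of finitely many of these
is positive everywhere, which contradicts that `Φ` preserves the order `1 + g = g`. -/
theorem exists_forall_apply_eq (Φ : Γ.RatFun →ₐ[TropicalSemifield] Γ.RatFun) (x : X) :
    ∃ x', ∀ f : Γ.RatFun, f x' = Φ f x := by
  by_contra hno
  push Not at hno
  have hcompact := Γ.compactSpace
  obtain ⟨g, hpos, hneg⟩ : ∃ g : Γ.RatFun, (∀ y ∈ (univ : Set X), 0 < g y) ∧ Φ g x < 0 := by
    refine isCompact_univ.induction_on (p := fun K => ∃ g : Γ.RatFun, (∀ y ∈ K, 0 < g y) ∧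
      Φ g x < 0) ?_ ?_ ?_ ?_
    · refine ⟨0, fun y hy => hy.elim, ?_⟩
      rw [map_zero, zero_apply]
      exact EReal.bot_lt_zero
    · rintro K K' hK ⟨g, hg, hgx⟩
      exact ⟨g, fun y hy => hg y (hK hy), hgx⟩
    · rintro K K' ⟨g, hg, hgx⟩ ⟨g', hg', hgx'⟩
      refine ⟨g + g', ?_, ?_⟩
      · rintro y (hy | hy)
        · exact lt_max_of_lt_left (hg y hy)
        · exact lt_max_of_lt_right (hg' y hy)
      · rw [map_add, add_apply]
        exact max_lt hgx hgx'
    · intro x' _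
      -- a function that is larger at `x'` than its image is at `x`
      have key : ∀ f : Γ.RatFun, Φ f x < f x' → ∃ t ∈ 𝓝[univ] x', ∃ g : Γ.RatFun,
          (∀ y ∈ t, 0 < g y) ∧ Φ g x < 0 := by
        intro f hf
        -- Subtracting a real constant strictly between the two values separates them by `0`; `Φ`
        -- commutes with this because it is `T`-linear.
        obtain ⟨c, hc1, hc2⟩ := EReal.lt_iff_exists_real_btwn.1 hf
        have hneg : ((-c : ℝ) : EReal) + (c : EReal) = 0 := by
          rw [← EReal.coe_add]
          simp
        refine ⟨{y | 0 < (realConst Γ (-c) * f) y}, ?_, realConst Γ (-c) * f, fun y hy => hy, ?_⟩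
        · rw [nhdsWithin_univ]
          refine (realConst Γ (-c) * f).2.continuous.continuousAt.eventually_const_lt ?_
          change 0 < (realConst Γ (-c) * f) x'
          rw [realConst_mul_apply, ← hneg]
          exact EReal.add_lt_add_left_coe hc2 _
        · rw [map_mul, map_realConst, realConst_mul_apply, ← hneg]
          exact EReal.add_lt_add_left_coe hc1 _
      obtain ⟨f, hf⟩ := hno x'
      -- If the inequality has the wrong direction, the tropical inverse of `f` reverses it, and `Φ`
      -- preserves inverses.
      rcases lt_or_gt_of_ne hf with hlt | hlt
      · have h0 : f ≠ 0 := by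
          rintro rfl
          rw [map_zero, zero_apply, zero_apply] at hlt
          exact lt_irrefl _ hlt
        obtain ⟨g, hg⟩ := exists_mul_eq_one h0
        have hg' : Φ g * Φ f = 1 := by rw [← map_mul, hg, map_one]
        refine key g ?_
        rw [apply_of_mul_eq_one hg, apply_of_mul_eq_one hg']
        exact EReal.neg_lt_neg_iff.2 hlt
      · exact key f hlt
  have h1 : 1 + g = g := ext_apply fun y => max_eq_right (hpos y (mem_univ y)).le
  have h2 : (1 + Φ g) x = Φ g x := by
    rw [← map_one Φ, ← map_add, h1]
  rw [add_apply, one_apply] at h2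
  exact absurd ((le_max_left _ _).trans h2.le) (not_le.2 hneg)

end RatFun

/-! ### Local isometries -/

/-- A map that does not increase the distance locally does not increase it globally. -/
theorem dist_map_le_of_local {σ : X → X}
    (hc : ∀ x ∈ Γ.finitePoints, Continuous fun y => Γ.dist (σ x) (σ y))
    (h : ∀ x ∈ Γ.finitePoints, ∃ δ, 0 < δ ∧ ∀ y, Γ.dist x y < δ →
      Γ.dist (σ x) (σ y) ≤ Γ.dist x y) (x y : X) :
    Γ.dist (σ x) (σ y) ≤ Γ.dist x y := by
  have key : ∀ e s t, s ≤ t → t ≤ Γ.len e →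
      Γ.dist (σ (Γ.edge e s)) (σ (Γ.edge e t)) ≤ gap s t := by
    intro e s t hst ht
    rcases eq_or_lt_of_le hst with rfl | hlt
    · rw [Γ.dist_self]
      exact zero_le
    rcases eq_or_ne t ⊤ with rfl | htop
    · rw [gap_comm, gap_top_left hlt.ne]
      exact le_top
    have hfin : ∀ u, u ≤ t → Γ.edge e u ∈ Γ.finitePoints := fun u hu =>
      Γ.edge_mem_finitePoints (hu.trans ht) (hu.trans_lt htop.lt_top).ne
    have hcl : IsClosed ({u | Γ.dist (σ (Γ.edge e s)) (σ (Γ.edge e u)) ≤ u - s} ∩ Icc s t) := by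
      have h1 : ContinuousOn (fun u => Γ.dist (σ (Γ.edge e s)) (σ (Γ.edge e u))) (Icc s t) :=
        (hc _ (hfin s hst)).comp_continuousOn
          ((Γ.continuousOn_edge e).mono fun u hu => hu.2.trans ht)
      have h2 := isClosed_Icc.isClosed_le h1 (ENNReal.continuous_sub_right s).continuousOn
      rwa [inter_comm]
    -- Continuation along the edge: the set of parameters with the estimate is closed, and the local
    -- hypothesis at any of its points `u < t` extends the estimate to the right, since lengths of
    -- adjacent segments add up.
    have hsub := hcl.Icc_subset_of_forall_exists_gt (by simp [Γ.dist_self])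
      fun u ⟨hu, hus, hut⟩ y hy => by
      obtain ⟨δ, hδ, H⟩ := h _ (hfin u hut.le)
      have hutop : u ≠ ⊤ := (hut.trans_le le_top).ne
      obtain ⟨v, huv, hv⟩ := exists_between
        (lt_min (lt_min (mem_Ioi.1 hy) hut) (ENNReal.lt_add_right hutop hδ.ne'))
      have hvy : v < y := hv.trans_le ((min_le_left _ _).trans (min_le_left _ _))
      have hvt : v < t := hv.trans_le ((min_le_left _ _).trans (min_le_right _ _))
      have hvδ : v - u < δ := ENNReal.sub_lt_of_lt_add huv.le
        (by rw [add_comm]; exact hv.trans_le (min_le_right _ _))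
      refine ⟨v, ?_, huv, hvy.le⟩
      have hd : Γ.dist (Γ.edge e u) (Γ.edge e v) ≤ v - u := by
        rw [← gap_of_le huv.le]
        exact Γ.dist_edge_le (hut.le.trans ht) (hvt.le.trans ht)
      calc Γ.dist (σ (Γ.edge e s)) (σ (Γ.edge e v))
          ≤ Γ.dist (σ (Γ.edge e s)) (σ (Γ.edge e u)) +
            Γ.dist (σ (Γ.edge e u)) (σ (Γ.edge e v)) := Γ.dist_triangle _ _ _
        _ ≤ (u - s) + (v - u) := add_le_add hu ((H _ (hd.trans_lt hvδ)).trans hd)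
        _ = v - s := by rw [add_comm, tsub_add_tsub_cancel huv.le hus]
    rw [gap_of_le hst]
    exact hsub ⟨hst, le_rfl⟩
  refine Γ.dist_map_le_of_edge (fun e s t hs ht => ?_) x y
  rcases le_total s t with hst | hst
  · exact key e s t hst ht
  · rw [Γ.dist_comm, gap_comm]
    exact key e t s hst hs

/-! ### From algebra automorphisms to isometries and back -/

namespace RatFun

variable [T2Space X]

variable {Φ : Γ.RatFun →ₐ[TropicalSemifield] Γ.RatFun} {σ : X → X}

/-- The evaluations embed the compact curve into a power of `EReal`. So `X` carries the coarsest
topology that makes all rational functions continuous, and it suffices that every `f ∘ σ = Φ f` is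
continuous. -/
theorem continuous_of_forall_apply_eq (hσ : ∀ (f : Γ.RatFun) x, f (σ x) = Φ f x) :
    Continuous σ := by
  have := Γ.compactSpace
  have hc : Continuous fun (x : X) (f : Γ.RatFun) => f x :=
    continuous_pi fun f => f.2.continuous
  have he := hc.isClosedEmbedding fun x y h => eq_of_forall_apply_eq (congrFun h)
  refine he.isInducing.continuous_iff.2 (continuous_pi fun f => ?_)
  exact (Φ f).2.continuous.congr fun x => (hσ f x).symm

/-- A point at infinity is a pole of the distance from the source of its edge, whereas the image of
this function under `Φ` has no pole at the finite point `x`. -/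
theorem map_mem_finitePoints (hσ : ∀ (f : Γ.RatFun) x, f (σ x) = Φ f x) {x : X}
    (hx : x ∈ Γ.finitePoints) : σ x ∈ Γ.finitePoints := by
  rintro ⟨e, he, h⟩
  have hy := Γ.point_src_mem_finitePoints e
  have h1 := hσ (Γ.distFun _ hy) x
  have h2 := dist_tgt_eq_top hy he
  rw [← Γ.edge_len, he, ← h] at h2
  rw [distFun_apply, h2] at h1
  exact (Φ _).ne_top hx h1.symm

/-- The function `dist (σ x) (σ ·)` is the image under `Φ` of a rational function, so near `x` it
equals `n * dist x ·` with an integer `n` that depends on the point. It is nonnegative and, by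
injectivity, nonzero off `x`; hence `n ≥ 1`. The upper bound keeps `σ y` so close to `σ x` that the
lower bound for the inverse map applies there. -/
theorem eventually_dist_le_dist_map (hσ : ∀ (f : Γ.RatFun) x, f (σ x) = Φ f x)
    (hinj : Function.Injective σ) {x : X} (hx : x ∈ Γ.finitePoints) :
    ∀ᶠ k : ℕ in atTop, ∀ y, Γ.dist x y < (k : ℝ≥0∞)⁻¹ →
      Γ.dist x y ≤ Γ.dist (σ x) (σ y) ∧ Γ.dist (σ x) (σ y) ≤ k * Γ.dist x y := by
  have hval : ∀ y, Φ (Γ.distFun _ (map_mem_finitePoints hσ hx)) y =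
      ((Γ.dist (σ x) (σ y) : ℝ≥0∞) : EReal) := fun y => (hσ _ y).symm
  have hloc : Γ.IsLocallyAffineAt (Φ (Γ.distFun _ (map_mem_finitePoints hσ hx))) x := by
    rcases (isRational_iff.1 (Φ (Γ.distFun _ (map_mem_finitePoints hσ hx))).2).2 with h | h
    · exact absurd ((hval x).symm.trans (h x)) (EReal.coe_ennreal_ne_bot _)
    · exact h.2.1 x hx
  refine hloc.mono fun k hk y hy => ?_
  rcases eq_or_ne y x with rfl | hne
  · simp [Γ.dist_self]
  obtain ⟨n, hn, h⟩ := hk y hy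
  have hr : Γ.dist x y ≠ ⊤ := (hy.trans_le le_top).ne
  have hr0 : 0 < (Γ.dist x y).toReal :=
    ENNReal.toReal_pos (fun h0 => hne (Γ.eq_of_dist_eq_zero h0).symm) hr
  rw [hval, hval, Γ.dist_self, EReal.coe_ennreal_zero, zero_add] at h
  have hρ : Γ.dist (σ x) (σ y) ≠ ⊤ := fun h' => by
    rw [h', EReal.coe_ennreal_top] at h
    exact EReal.coe_ne_top _ h.symm
  have hρ0 : 0 < (Γ.dist (σ x) (σ y)).toReal :=
    ENNReal.toReal_pos (fun h0 => hne (hinj (Γ.eq_of_dist_eq_zero h0)).symm) hρ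
  rw [EReal.coe_ennreal_eq_coe_toReal hρ, EReal.coe_eq_coe_iff] at h
  have hn1 : (1 : ℝ) ≤ n := by
    have : (0 : ℝ) < n := pos_of_mul_pos_left (h ▸ hρ0) hr0.le
    exact_mod_cast this
  have hnk : (n : ℝ) ≤ k := by exact_mod_cast (le_abs_self n).trans hn
  constructor
  · rw [← ENNReal.toReal_le_toReal hr hρ, h]
    nlinarith
  · rw [← ENNReal.toReal_le_toReal hρ (ENNReal.mul_ne_top (ENNReal.natCast_ne_top k) hr), h,
      ENNReal.toReal_mul, ENNReal.toReal_natCast]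
    exact mul_le_mul_of_nonneg_right hnk hr0.le

/-- Automorphisms of the algebra of rational functions come from isometries. -/
theorem exists_isIsometry (Φ : Γ.RatFun ≃ₐ[TropicalSemifield] Γ.RatFun) :
    ∃ σ : Equiv.Perm X, Γ.IsIsometry σ ∧ ∀ (f : Γ.RatFun) x, f (σ x) = Φ f x := by
  choose σ hσ using fun x => exists_forall_apply_eq (Φ : Γ.RatFun →ₐ[TropicalSemifield] Γ.RatFun) x
  choose τ hτ using fun x =>
    exists_forall_apply_eq (Φ.symm : Γ.RatFun →ₐ[TropicalSemifield] Γ.RatFun) x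
  replace hσ : ∀ (f : Γ.RatFun) x, f (σ x) = (Φ : Γ.RatFun →ₐ[TropicalSemifield] Γ.RatFun) f x :=
    fun f x => hσ x f
  replace hτ : ∀ (f : Γ.RatFun) x,
      f (τ x) = (Φ.symm : Γ.RatFun →ₐ[TropicalSemifield] Γ.RatFun) f x := fun f x => hτ x f
  have hτσ : ∀ x, τ (σ x) = x := fun x => eq_of_forall_apply_eq fun f => by
    rw [hτ, hσ]
    exact congrArg (fun f : Γ.RatFun => f x) (Φ.apply_symm_apply f)
  have hστ : ∀ x, σ (τ x) = x := fun x => eq_of_forall_apply_eq fun f => by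
    rw [hσ, hτ]
    exact congrArg (fun f : Γ.RatFun => f x) (Φ.symm_apply_apply f)
  have key : ∀ {Φ Ψ : Γ.RatFun →ₐ[TropicalSemifield] Γ.RatFun} {σ τ : X → X},
      (∀ (f : Γ.RatFun) x, f (σ x) = Φ f x) → (∀ (f : Γ.RatFun) x, f (τ x) = Ψ f x) →
      (∀ x, τ (σ x) = x) → (∀ x, σ (τ x) = x) → ∀ x y, Γ.dist (σ x) (σ y) ≤ Γ.dist x y := by
    intro Φ Ψ σ τ hσ hτ hτσ hστ
    have hcσ := continuous_of_forall_apply_eq hσ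
    refine dist_map_le_of_local
      (fun x hx => (continuous_dist (map_mem_finitePoints hσ hx)).comp hcσ) fun x hx => ?_
    obtain ⟨k, hk, hk1⟩ := ((eventually_dist_le_dist_map hσ
      (Function.LeftInverse.injective hτσ) hx).and (eventually_ge_atTop 1)).exists
    obtain ⟨m, hm⟩ := (eventually_dist_le_dist_map hτ
      (Function.LeftInverse.injective hστ) (map_mem_finitePoints hσ hx)).exists
    have hk0 : (k : ℝ≥0∞) ≠ 0 := by
      rw [Nat.cast_ne_zero]
      omega
    -- The second radius forces `k * dist x y < 1 / m`. Then `σ y` lies in the ball around `σ x` on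
    -- which `τ` does not shrink distances, and `τ ∘ σ = id` gives the reverse inequality.
    refine ⟨min (k : ℝ≥0∞)⁻¹ ((m : ℝ≥0∞)⁻¹ / k), lt_min (by simp) (ENNReal.div_pos (by simp)
      (ENNReal.natCast_ne_top k)), fun y hy => ?_⟩
    have h1 := (hk y (hy.trans_le (min_le_left _ _))).2
    have h2 := hy.trans_le (min_le_right _ _)
    rw [ENNReal.lt_div_iff_mul_lt (Or.inl hk0) (Or.inl (ENNReal.natCast_ne_top k)), mul_comm] at h2
    have h3 := (hm (σ y) (h1.trans_lt h2)).1
    rwa [hτσ, hτσ] at h3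
  refine ⟨⟨σ, τ, hτσ, hστ⟩, ⟨continuous_of_forall_apply_eq hσ, fun x y =>
    le_antisymm (key hσ hτ hτσ hστ x y) ?_⟩, hσ⟩
  have := key hτ hσ hστ hτσ (σ x) (σ y)
  rwa [hτσ, hτσ] at this

/-- The composition of a rational function with an isometry. -/
def comp (f : Γ.RatFun) (σ : Equiv.Perm X) (hσ : Γ.IsIsometry σ) : Γ.RatFun :=
  ⟨fun x => f (σ x), hσ.isRational_comp f.2⟩

theorem comp_apply (f : Γ.RatFun) (σ : Equiv.Perm X) (hσ : Γ.IsIsometry σ) (x : X) :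
    f.comp σ hσ x = f (σ x) := rfl

/-- The pullback of rational functions along an isometry. -/
def pullback (σ : Equiv.Perm X) (hσ : Γ.IsIsometry σ) :
    Γ.RatFun →ₐ[TropicalSemifield] Γ.RatFun where
  toFun f := f.comp σ hσ
  map_one' := rfl
  map_zero' := rfl
  map_add' _ _ := rfl
  map_mul' f g := ext_of_finitePoints fun x hx => by
    rw [comp_apply, mul_apply _ _ (hσ.mem_finitePoints.2 hx), mul_apply _ _ hx, comp_apply,
      comp_apply]
  commutes' _ := rfl

theorem pullback_apply (σ : Equiv.Perm X) (hσ : Γ.IsIsometry σ) (f : Γ.RatFun) :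
    pullback σ hσ f = f.comp σ hσ := rfl

/-- The pullback of rational functions along the inverse of an isometry is an automorphism. -/
def pullbackEquiv (σ : Equiv.Perm X) (hσ : Γ.IsIsometry σ) :
    Γ.RatFun ≃ₐ[TropicalSemifield] Γ.RatFun :=
  AlgEquiv.ofAlgHom (pullback σ⁻¹ hσ.inv) (pullback σ hσ)
    (AlgHom.ext fun f => ext_apply fun x => by
      rw [AlgHom.comp_apply, pullback_apply, pullback_apply, comp_apply, comp_apply,
        AlgHom.id_apply]
      exact congrArg f.1 (σ.apply_symm_apply x))
    (AlgHom.ext fun f => ext_apply fun x => by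
      rw [AlgHom.comp_apply, pullback_apply, pullback_apply, comp_apply, comp_apply,
        AlgHom.id_apply]
      exact congrArg f.1 (σ.symm_apply_apply x))

end RatFun

/-! ### The isometry group and the algebra automorphisms -/

variable [T2Space X]

variable (Γ) in
/-- The group of isometries of a tropical curve. -/
def isometryGroup : Subgroup (Equiv.Perm X) where
  carrier := {σ | Γ.IsIsometry σ}
  mul_mem' := IsIsometry.mul
  one_mem' := IsIsometry.one
  inv_mem' := IsIsometry.inv

variable (Γ) in
/-- The action of the isometries on the rational functions. -/
def isometryGroupHom : Γ.isometryGroup →* (Γ.RatFun ≃ₐ[TropicalSemifield] Γ.RatFun) where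
  toFun σ := RatFun.pullbackEquiv σ σ.2
  map_one' := rfl
  map_mul' σ τ := AlgEquiv.ext fun f => RatFun.ext_apply fun x => by
    -- Pulling back reverses the order of composition, and the inverses restore it.
    change f ((σ * τ : Equiv.Perm X)⁻¹ x) = f ((τ : Equiv.Perm X)⁻¹ ((σ : Equiv.Perm X)⁻¹ x))
    rw [mul_inv_rev, Equiv.Perm.mul_apply]

theorem isometryGroupHom_apply (σ : Γ.isometryGroup) (f : Γ.RatFun) (x : X) :
    (Γ.isometryGroupHom σ f : Γ.RatFun) x = f ((σ : Equiv.Perm X)⁻¹ x) := by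
  rfl

/-- Injectivity is the separation of points by rational functions. For surjectivity, the isometry
that belongs to `Φ` has to be inverted, since the action is by pullback along inverses. -/
theorem isometryGroupHom_bijective : Function.Bijective Γ.isometryGroupHom := by
  constructor
  · intro σ τ h
    have h1 : ∀ x, (σ : Equiv.Perm X)⁻¹ x = (τ : Equiv.Perm X)⁻¹ x := fun x =>
      RatFun.eq_of_forall_apply_eq fun f => by
        rw [← isometryGroupHom_apply, ← isometryGroupHom_apply, h]
    exact Subtype.ext (inv_injective (Equiv.ext h1))
  · intro Φ
    obtain ⟨σ, hσ, h⟩ := RatFun.exists_isIsometry Φ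
    refine ⟨⟨σ⁻¹, hσ.inv⟩, AlgEquiv.ext fun f => RatFun.ext_apply fun x => ?_⟩
    rw [isometryGroupHom_apply, ← h]
    simp

end TropicalCurve

/-! ### Subdivision of a graph -/

namespace Multigraph

/-- The graph obtained by inserting a vertex in the middle of every edge. -/
def subdivide (G : Multigraph) : Multigraph where
  V := G.V ⊕ G.E
  E := G.E ⊕ G.E
  src := Sum.elim (fun e => Sum.inl (G.src e)) Sum.inr
  tgt := Sum.elim Sum.inr (fun e => Sum.inl (G.tgt e))

theorem loopless_subdivide (G : Multigraph) : G.subdivide.Loopless := by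
  rintro (e | e) h
  · exact Sum.inl_ne_inr h
  · exact Sum.inr_ne_inl h

/-- This keeps the ends of infinite edges leaf ends after the subdivision. -/
theorem valence_subdivide_inl (G : Multigraph) (v : G.V) :
    G.subdivide.valence (Sum.inl v : G.V ⊕ G.E) = G.valence v := by
  classical
  refine congrArg₂ (· + ·) (Eq.symm ?_) (Eq.symm ?_)
  · refine Finset.card_bij (fun e _ => (Sum.inl e : G.E ⊕ G.E)) (fun e he => ?_)
      (fun _ _ _ _ h => Sum.inl_injective h) ?_
    · exact Finset.mem_filter.2 ⟨Finset.mem_univ _, congrArg Sum.inl (Finset.mem_filter.1 he).2⟩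
    · rintro (e | e) he
      · exact ⟨e, Finset.mem_filter.2 ⟨Finset.mem_univ _,
          Sum.inl_injective (Finset.mem_filter.1 he).2⟩, rfl⟩
      · exact absurd (Finset.mem_filter.1 he).2 Sum.inr_ne_inl
  · refine Finset.card_bij (fun e _ => (Sum.inr e : G.E ⊕ G.E)) (fun e he => ?_)
      (fun _ _ _ _ h => Sum.inr_injective h) ?_
    · exact Finset.mem_filter.2 ⟨Finset.mem_univ _, congrArg Sum.inl (Finset.mem_filter.1 he).2⟩
    · rintro (e | e) he
      · exact absurd (Finset.mem_filter.1 he).2 Sum.inr_ne_inl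
      · exact ⟨e, Finset.mem_filter.2 ⟨Finset.mem_univ _,
          Sum.inl_injective (Finset.mem_filter.1 he).2⟩, rfl⟩

theorem connected_subdivide {G : Multigraph} (hG : G.Connected) : G.subdivide.Connected := by
  obtain ⟨⟨v₀⟩, hG⟩ := hG
  refine ⟨⟨(Sum.inl v₀ : G.V ⊕ G.E)⟩, ?_⟩
  set r : G.V ⊕ G.E → G.V ⊕ G.E → Prop := fun a b =>
    ∃ e, (G.subdivide.src e = a ∧ G.subdivide.tgt e = b) ∨
      (G.subdivide.src e = b ∧ G.subdivide.tgt e = a) with hr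
  have hsymm : Std.Symm r := ⟨fun a b ⟨e, h⟩ => ⟨e, h.symm⟩⟩
  have hsrc : ∀ e, r (Sum.inl (G.src e)) (Sum.inr e) := fun e =>
    ⟨(Sum.inl e : G.E ⊕ G.E), Or.inl ⟨rfl, rfl⟩⟩
  have htgt : ∀ e, r (Sum.inr e) (Sum.inl (G.tgt e)) := fun e =>
    ⟨(Sum.inr e : G.E ⊕ G.E), Or.inl ⟨rfl, rfl⟩⟩
  have hinl : ∀ v, Relation.ReflTransGen r (Sum.inl v₀) (Sum.inl v) := by
    intro v
    induction hG v₀ v with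
    | refl => exact .refl
    | tail _ hab ih =>
      obtain ⟨e, ⟨rfl, rfl⟩ | ⟨rfl, rfl⟩⟩ := hab
      · exact (ih.tail (hsrc e)).tail (htgt e)
      · exact (ih.tail (hsymm.symm _ _ (htgt e))).tail (hsymm.symm _ _ (hsrc e))
  have hall : ∀ v, Relation.ReflTransGen r (Sum.inl v₀) v := by
    rintro (v | e)
    · exact hinl v
    · exact (hinl _).tail (hsrc e)
  exact fun u v => ((Relation.ReflTransGen.stdSymm (r := r)).symm _ _ (hall u)).trans (hall v)

end Multigraph

/-! ### Subdivision and transport of a tropical curve -/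

namespace TropicalCurve

variable {X : Type*} [TopologicalSpace X] (Γ : TropicalCurve X)

theorem incident_iff {e : Γ.E} {v : Γ.V} : Γ.Incident e v ↔ Γ.point v ∈ Γ.edgeSet e := by
  constructor
  · rintro (rfl | rfl)
    · exact ⟨0, mem_Iic.2 zero_le, Γ.edge_zero e⟩
    · exact ⟨_, mem_Iic.2 le_rfl, Γ.edge_len e⟩
  · rintro ⟨s, hs, h⟩
    rcases eq_or_ne s 0 with rfl | h0
    · exact Or.inl (Γ.point_injective ((Γ.edge_zero e).symm.trans h))
    rcases eq_or_lt_of_le (mem_Iic.1 hs) with rfl | hlt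
    · exact Or.inr (Γ.point_injective ((Γ.edge_len e).symm.trans h))
    · exact absurd h (Γ.edge_ne_point e s ⟨pos_iff_ne_zero.2 h0, hlt⟩ v)

/-- A parameter in the interior of an edge. -/
def mid (e : Γ.E) : ℝ≥0∞ := if Γ.len e = ⊤ then 1 else Γ.len e / 2

theorem mid_pos (e : Γ.E) : 0 < Γ.mid e := by
  unfold mid
  split_ifs
  · exact one_pos
  · exact ENNReal.half_pos (Γ.len_pos e).ne'

theorem mid_lt (e : Γ.E) : Γ.mid e < Γ.len e := by
  unfold mid
  split_ifs with h
  · exact h ▸ ENNReal.one_lt_top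
  · exact ENNReal.half_lt_self (Γ.len_pos e).ne' h

theorem mid_ne_top (e : Γ.E) : Γ.mid e ≠ ⊤ := ((Γ.mid_lt e).trans_le le_top).ne

theorem mid_add_le {e : Γ.E} {s : ℝ≥0∞} (hs : s ≤ Γ.len e - Γ.mid e) :
    Γ.mid e + s ≤ Γ.len e :=
  (add_le_add le_rfl hs).trans (add_tsub_cancel_of_le (Γ.mid_lt e).le).le

theorem mid_add_mem_Ioo {e : Γ.E} {s : ℝ≥0∞} (hs : s ∈ Ioo 0 (Γ.len e - Γ.mid e)) :
    Γ.mid e + s ∈ Ioo 0 (Γ.len e) := by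
  refine ⟨(Γ.mid_pos e).trans_le le_self_add, ?_⟩
  rw [add_comm]
  exact lt_tsub_iff_right.1 hs.2

theorem gap_add_left {m : ℝ≥0∞} (hm : m ≠ ⊤) (s t : ℝ≥0∞) : gap (m + s) (m + t) = gap s t := by
  unfold gap
  rw [ENNReal.add_sub_add_eq_sub_left hm, ENNReal.add_sub_add_eq_sub_left hm]

/-- The subdivision of the curve at an interior point of every edge. -/
def subdivide : TropicalCurve X where
  toMultigraph := Γ.toMultigraph.subdivide
  connected := Multigraph.connected_subdivide Γ.connected
  len := Sum.elim Γ.mid fun e => Γ.len e - Γ.mid e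
  len_pos := by
    rintro (e | e)
    · exact Γ.mid_pos e
    · exact tsub_pos_of_lt (Γ.mid_lt e)
  leaf_of_len_eq_top := by
    rintro (e | e) he
    · exact absurd he (Γ.mid_ne_top e)
    · exact (Multigraph.valence_subdivide_inl _ _).trans
        (Γ.leaf_of_len_eq_top e (ENNReal.sub_eq_top_iff.1 he).1)
  point := Sum.elim Γ.point fun e => Γ.edge e (Γ.mid e)
  edge := Sum.elim Γ.edge fun e s => Γ.edge e (Γ.mid e + s)
  continuousOn_edge := by
    rintro (e | e)
    · exact (Γ.continuousOn_edge e).mono (Iic_subset_Iic.2 (Γ.mid_lt e).le)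
    · exact (Γ.continuousOn_edge e).comp (continuous_const.add continuous_id).continuousOn
        fun s hs => Γ.mid_add_le hs
  edge_zero := by
    rintro (e | e)
    · exact Γ.edge_zero e
    · exact congrArg _ (add_zero _)
  edge_len := by
    rintro (e | e)
    · rfl
    · exact (congrArg _ (add_tsub_cancel_of_le (Γ.mid_lt e).le)).trans (Γ.edge_len e)
  point_injective := by
    rintro (v | e) (w | e') h
    · exact congrArg Sum.inl (Γ.point_injective h)
    · exact absurd h.symm (Γ.edge_ne_point _ _ ⟨Γ.mid_pos e', Γ.mid_lt e'⟩ v)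
    · exact absurd h (Γ.edge_ne_point _ _ ⟨Γ.mid_pos e, Γ.mid_lt e⟩ w)
    · exact congrArg Sum.inr (Γ.edge_injective _ _ _ _ ⟨Γ.mid_pos e, Γ.mid_lt e⟩
        ⟨Γ.mid_pos e', Γ.mid_lt e'⟩ h).1
  edge_ne_point := by
    rintro (e | e) s hs (v | e') h
    · exact Γ.edge_ne_point e s ⟨hs.1, hs.2.trans (Γ.mid_lt e)⟩ v h
    · obtain ⟨rfl, rfl⟩ := Γ.edge_injective _ _ _ _ ⟨hs.1, hs.2.trans (Γ.mid_lt e)⟩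
        ⟨Γ.mid_pos e', Γ.mid_lt e'⟩ h
      exact lt_irrefl _ hs.2
    · exact Γ.edge_ne_point e _ (Γ.mid_add_mem_Ioo hs) v h
    · obtain ⟨rfl, h⟩ := Γ.edge_injective _ _ _ _ (Γ.mid_add_mem_Ioo hs)
        ⟨Γ.mid_pos e', Γ.mid_lt e'⟩ h
      exact (ENNReal.lt_add_right (Γ.mid_ne_top e) hs.1.ne').ne' h
  edge_injective := by
    rintro (e | e) (e' | e') s s' hs hs' h
    · obtain ⟨rfl, rfl⟩ := Γ.edge_injective _ _ _ _ ⟨hs.1, hs.2.trans (Γ.mid_lt e)⟩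
        ⟨hs'.1, hs'.2.trans (Γ.mid_lt e')⟩ h
      exact ⟨rfl, rfl⟩
    · obtain ⟨rfl, rfl⟩ := Γ.edge_injective _ _ _ _ ⟨hs.1, hs.2.trans (Γ.mid_lt e)⟩
        (Γ.mid_add_mem_Ioo hs') h
      exact absurd hs.2 (not_lt.2 le_self_add)
    · obtain ⟨rfl, rfl⟩ := Γ.edge_injective _ _ _ _ (Γ.mid_add_mem_Ioo hs)
        ⟨hs'.1, hs'.2.trans (Γ.mid_lt e')⟩ h
      exact absurd hs'.2 (not_lt.2 le_self_add)
    · obtain ⟨rfl, h⟩ := Γ.edge_injective _ _ _ _ (Γ.mid_add_mem_Ioo hs)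
        (Γ.mid_add_mem_Ioo hs') h
      exact ⟨rfl, (ENNReal.add_right_inj (Γ.mid_ne_top e)).1 h⟩
  cover := by
    intro x
    rcases Γ.cover x with ⟨v, rfl⟩ | ⟨e, s, hs, rfl⟩
    · exact Or.inl ⟨(Sum.inl v : Γ.V ⊕ Γ.E), rfl⟩
    · rcases lt_trichotomy s (Γ.mid e) with h | rfl | h
      · exact Or.inr ⟨(Sum.inl e : Γ.E ⊕ Γ.E), s, ⟨hs.1, h⟩, rfl⟩
      · exact Or.inl ⟨(Sum.inr e : Γ.V ⊕ Γ.E), rfl⟩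
      · refine Or.inr ⟨(Sum.inr e : Γ.E ⊕ Γ.E), s - Γ.mid e, ⟨tsub_pos_of_lt h, ?_⟩, ?_⟩
        · exact ENNReal.sub_lt_of_lt_add h.le
            (hs.2.trans_eq (tsub_add_cancel_of_le (Γ.mid_lt e).le).symm)
        · exact congrArg _ (add_tsub_cancel_of_le h.le).symm

theorem loopless_subdivide : Γ.subdivide.Loopless := Γ.toMultigraph.loopless_subdivide

/-- A segment of an old edge splits at the new vertex into segments of the two parts whose lengths
add up, and a segment of a part is a segment of the old edge. -/
theorem isModelOf_subdivide : Γ.subdivide.IsModelOf Γ := by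
  refine fun x y => le_antisymm ?_ ?_
  · have hleft : ∀ e s t, s ≤ Γ.mid e → t ≤ Γ.mid e →
        Γ.subdivide.dist (Γ.edge e s) (Γ.edge e t) ≤ gap s t := fun e s t hs ht =>
      Γ.subdivide.dist_edge_le (e := (Sum.inl e : Γ.E ⊕ Γ.E)) hs ht
    have hright : ∀ e s t, Γ.mid e ≤ s → Γ.mid e ≤ t → s ≤ Γ.len e → t ≤ Γ.len e →
        Γ.subdivide.dist (Γ.edge e s) (Γ.edge e t) ≤ gap s t := by
      intro e s t hs ht hsl htl
      have h := Γ.subdivide.dist_edge_le (e := (Sum.inr e : Γ.E ⊕ Γ.E))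
        (s := s - Γ.mid e) (t := t - Γ.mid e) (tsub_le_tsub_right hsl _)
        (tsub_le_tsub_right htl _)
      rw [← gap_add_left (Γ.mid_ne_top e), add_tsub_cancel_of_le hs,
        add_tsub_cancel_of_le ht] at h
      change Γ.subdivide.dist (Γ.edge e (Γ.mid e + (s - Γ.mid e)))
        (Γ.edge e (Γ.mid e + (t - Γ.mid e))) ≤ _ at h
      rwa [add_tsub_cancel_of_le hs, add_tsub_cancel_of_le ht] at h
    have key : ∀ e s t, s ≤ t → t ≤ Γ.len e →
        Γ.subdivide.dist (Γ.edge e s) (Γ.edge e t) ≤ gap s t := by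
      intro e s t hst ht
      rcases le_total t (Γ.mid e) with h | h
      · exact hleft e s t (hst.trans h) h
      rcases le_total s (Γ.mid e) with h' | h'
      · refine (Γ.subdivide.dist_triangle _ (Γ.edge e (Γ.mid e)) _).trans
          ((add_le_add (hleft e _ _ h' le_rfl) (hright e _ _ le_rfl h (Γ.mid_lt e).le ht)).trans ?_)
        rw [gap_of_le h', gap_of_le h, gap_of_le hst, add_comm, tsub_add_tsub_cancel h h']
      · exact hright e s t h' h (hst.trans ht) ht
    refine Γ.dist_map_le_of_edge (φ := id) (Γ' := Γ.subdivide) (fun e s t hs ht => ?_) x y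
    rcases le_total s t with hst | hst
    · exact key e s t hst ht
    · rw [dist_comm, gap_comm]
      exact key e t s hst hs
  · refine Γ.subdivide.dist_map_le_of_edge (φ := id) (Γ' := Γ) ?_ x y
    rintro (e | e) s t hs ht
    · exact Γ.dist_edge_le (e := e) (hs.trans (Γ.mid_lt e).le) (ht.trans (Γ.mid_lt e).le)
    · rw [← gap_add_left (Γ.mid_ne_top e)]
      exact Γ.dist_edge_le (Γ.mid_add_le hs) (Γ.mid_add_le ht)

/-- The image of a curve under a homeomorphism. -/
def map (σ : Equiv.Perm X) (hσ : Continuous σ) : TropicalCurve X where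
  toEdgeWeightedGraph := Γ.toEdgeWeightedGraph
  point v := σ (Γ.point v)
  edge e s := σ (Γ.edge e s)
  continuousOn_edge e := hσ.comp_continuousOn (Γ.continuousOn_edge e)
  edge_zero e := congrArg σ (Γ.edge_zero e)
  edge_len e := congrArg σ (Γ.edge_len e)
  point_injective := σ.injective.comp Γ.point_injective
  edge_ne_point e s hs v h := Γ.edge_ne_point e s hs v (σ.injective h)
  edge_injective e e' s s' hs hs' h := Γ.edge_injective e e' s s' hs hs' (σ.injective h)
  cover x := by
    rcases Γ.cover (σ.symm x) with ⟨v, h⟩ | ⟨e, s, hs, h⟩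
    · exact Or.inl ⟨v, (σ.symm_apply_eq).1 h⟩
    · exact Or.inr ⟨e, s, hs, (σ.symm_apply_eq).1 h⟩

theorem map_dist (σ : Equiv.Perm X) (hσ : Continuous σ) (x y : X) :
    (Γ.map σ hσ).dist (σ x) (σ y) = Γ.dist x y := by
  refine le_antisymm ?_ ?_
  · exact Γ.dist_map_le_of_edge (φ := σ) (Γ' := Γ.map σ hσ)
      (fun e s t hs ht => (Γ.map σ hσ).dist_edge_le (e := e) hs ht) x y
  · have := (Γ.map σ hσ).dist_map_le_of_edge (φ := σ.symm) (Γ' := Γ) (fun e s t hs ht => by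
      change Γ.dist (σ.symm (σ (Γ.edge e s))) (σ.symm (σ (Γ.edge e t))) ≤ _
      rw [σ.symm_apply_apply, σ.symm_apply_apply]
      exact Γ.dist_edge_le hs ht) (σ x) (σ y)
    rwa [σ.symm_apply_apply, σ.symm_apply_apply] at this

theorem edgeSet_map (σ : Equiv.Perm X) (hσ : Continuous σ) (e : Γ.E) :
    (Γ.map σ hσ).edgeSet e = σ '' Γ.edgeSet e := (image_comp σ (Γ.edge e) _)

/-- An interior point determines its edge. In `IsHarmonicFor` edges are matched through their point
sets, so this is what leaves a single summand in the balancing sums of an isometry. -/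
theorem edgeSet_injective : Function.Injective Γ.edgeSet := by
  intro e e' h
  have hm := Γ.mid_lt e
  obtain ⟨s, hs, heq⟩ : Γ.edge e (Γ.mid e) ∈ Γ.edgeSet e' := h ▸ ⟨_, hm.le, rfl⟩
  rcases Γ.eq_or_endpoints_of_edge_eq hm.le hs heq.symm with h1 | ⟨h1 | h1, -⟩
  · exact h1.1
  · exact absurd h1 (Γ.mid_pos e).ne'
  · exact absurd h1 hm.ne

variable {Γ}

/-! ### Isometries are automorphisms -/

/-- The model on the target is the image under `σ` of the model on the source, so vertices and edges
correspond by construction and all degrees are one; it is a model of `Γ` precisely because `σ`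
preserves the distance. The subdivision removes loops. -/
theorem IsIsometry.isAutomorphism {σ : Equiv.Perm X} (hσ : Γ.IsIsometry σ) :
    Γ.IsAutomorphism σ := by
  classical
  refine ⟨hσ.continuous, ?_⟩
  by_cases hX : Subsingleton X
  · exact Or.inl ⟨hX, hX, one_pos⟩
  refine Or.inr ⟨fun h => hX h.1, Γ.subdivide, Γ.subdivide.map σ hσ.continuous, fun _ => 1,
    fun _ => 1, Γ.isModelOf_subdivide, fun x y => ?_, ⟨Γ.loopless_subdivide, Γ.loopless_subdivide,
    fun v => ⟨v, rfl⟩, fun e => ⟨e, (Γ.subdivide.edgeSet_map σ hσ.continuous e).symm⟩,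
    fun _ => one_pos, fun e x _ y _ => ?_, fun v v' e' hv he' => ?_⟩, fun v' => ?_⟩
  · obtain ⟨x, rfl⟩ := σ.surjective x
    obtain ⟨y, rfl⟩ := σ.surjective y
    rw [map_dist, Γ.isModelOf_subdivide, hσ.dist_map]
  · rw [map_dist, Nat.cast_one, one_mul]
  · have hvv : v = v' := Γ.subdivide.point_injective (σ.injective hv)
    subst hvv
    refine (Finset.sum_eq_single_of_mem e' ?_ fun e he hne => ?_)
    · exact Finset.mem_filter.2 ⟨Finset.mem_univ _, he', (Γ.subdivide.edgeSet_map σ hσ.continuous e').symm⟩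
    · refine absurd (Γ.subdivide.edgeSet_injective (σ.injective.image_injective ?_)) hne
      exact (Finset.mem_filter.1 he).2.2.trans (Γ.subdivide.edgeSet_map σ hσ.continuous e')
  · refine (Finset.sum_eq_single_of_mem v' ?_ fun v hv hne => ?_)
    · exact Finset.mem_filter.2 ⟨Finset.mem_univ _, rfl⟩
    · exact absurd
        (Γ.subdivide.point_injective (σ.injective (Finset.mem_filter.1 hv).2)) hne

/-! ### Automorphisms are isometries -/

open Classical in
-- Every vertex has an incident edge, so all local degrees are positive. As the degrees over a
-- vertex of the target add up to `1`, that vertex has exactly one preimage, and by balancing every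
-- incident edge has exactly one lift there, of degree one. So `φ` is bijective and isometric on
-- each edge; neither `φ` nor its inverse increases path lengths.
theorem IsHarmonicFor.bijective_and_dist_map {Y : Type*} [TopologicalSpace Y] [Nontrivial X]
    [Nontrivial Y] {M : TropicalCurve X} {M' : TropicalCurve Y} {φ : X → Y} {degE : M.E → ℕ}
    {degV : M.V → ℕ} (H : IsHarmonicFor M M' φ degE degV)
    (hdeg : ∀ v', ∑ v with φ (M.point v) = M'.point v', degV v = 1) :
    Function.Bijective φ ∧ ∀ x y, M'.dist (φ x) (φ y) = M.dist x y := by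
  have hincl : ∀ {e v e' v'}, M.Incident e v → φ '' M.edgeSet e = M'.edgeSet e' →
      φ (M.point v) = M'.point v' → M'.Incident e' v' := by
    intro e v e' v' hev he hv
    rw [M'.incident_iff, ← he, ← hv]
    exact mem_image_of_mem _ (M.incident_iff.1 hev)
  have hle : ∀ v e, M.Incident e v → degE e ≤ degV v := by
    intro v e hev
    obtain ⟨v', hv⟩ := H.map_vertex v
    obtain ⟨e', he⟩ := H.map_edge e
    rw [← H.balanced v v' e' hv (hincl hev he hv)]
    exact Finset.single_le_sum (f := degE) (fun _ _ => Nat.zero_le _)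
      (Finset.mem_filter.2 ⟨Finset.mem_univ _, hev, he⟩)
  have hV : ∀ v, degV v = 1 := by
    intro v
    obtain ⟨v', hv⟩ := H.map_vertex v
    have h1 : degV v ≤ 1 := by
      rw [← hdeg v']
      exact Finset.single_le_sum (f := degV) (fun _ _ => Nat.zero_le _)
        (Finset.mem_filter.2 ⟨Finset.mem_univ _, hv⟩)
    obtain ⟨e, he⟩ := M.exists_incident v
    have := hle v e he
    have := H.deg_pos e
    omega
  have hE : ∀ e, degE e = 1 := by
    intro e
    have := hle _ e (Or.inl rfl)
    rw [hV] at this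
    have := H.deg_pos e
    omega
  have hdist : ∀ e, ∀ x ∈ M.edgeSet e, ∀ y ∈ M.edgeSet e,
      M'.dist (φ x) (φ y) = M.dist x y := by
    intro e x hx y hy
    rw [H.dist_map e x hx y hy, hE, Nat.cast_one, one_mul]
  have hinj : ∀ e, ∀ x ∈ M.edgeSet e, ∀ y ∈ M.edgeSet e, φ x = φ y → x = y := by
    intro e x hx y hy h
    refine M.eq_of_dist_eq_zero ?_
    rw [← hdist e x hx y hy, h, M'.dist_self]
  have hvertex : ∀ {v w v'}, φ (M.point v) = M'.point v' → φ (M.point w) = M'.point v' →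
      v = w := by
    intro v w v' hv hw
    have h := hdeg v'
    simp only [hV, Finset.sum_const, smul_eq_mul, mul_one] at h
    exact Finset.card_le_one.1 h.le _ (by simpa using hv) _ (by simpa using hw)
  have hedge : ∀ {v e₁ e₂ e'}, M.Incident e₁ v → M.Incident e₂ v →
      φ '' M.edgeSet e₁ = M'.edgeSet e' → φ '' M.edgeSet e₂ = M'.edgeSet e' → e₁ = e₂ := by
    intro v e₁ e₂ e' h₁ h₂ he₁ he₂
    obtain ⟨v', hv⟩ := H.map_vertex v
    have h := H.balanced v v' e' hv (hincl h₁ he₁ hv)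
    simp only [hE, hV, Finset.sum_const, smul_eq_mul, mul_one] at h
    exact Finset.card_le_one.1 h.le _ (Finset.mem_filter.2 ⟨Finset.mem_univ _, h₁, he₁⟩) _
      (Finset.mem_filter.2 ⟨Finset.mem_univ _, h₂, he₂⟩)
  -- The two ends of `e` differ because `M` is loopless, and their images differ because vertices
  -- have unique preimages. Hence these images are the two ends of `e'`.
  have hends : ∀ {e e' v'}, φ '' M.edgeSet e = M'.edgeSet e' → M'.Incident e' v' →
      ∃ v, M.Incident e v ∧ φ (M.point v) = M'.point v' := by
    intro e e' v' he hv'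
    obtain ⟨u', hu⟩ := H.map_vertex (M.src e)
    obtain ⟨w', hw⟩ := H.map_vertex (M.tgt e)
    have hu' := hincl (Or.inl rfl) he hu
    have hw' := hincl (Or.inr rfl) he hw
    have hne : u' ≠ w' := by
      rintro rfl
      exact H.loopless e (hvertex hu hw)
    have : v' = u' ∨ v' = w' := by
      rcases hu' with hu' | hu' <;> rcases hw' with hw' | hw' <;> rcases hv' with hv' | hv'
      · exact absurd (hu'.symm.trans hw') hne
      · exact absurd (hu'.symm.trans hw') hne
      · exact Or.inl (hv'.symm.trans hu')
      · exact Or.inr (hv'.symm.trans hw')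
      · exact Or.inr (hv'.symm.trans hw')
      · exact Or.inl (hv'.symm.trans hu')
      · exact absurd (hu'.symm.trans hw') hne
      · exact absurd (hu'.symm.trans hw') hne
    rcases this with rfl | rfl
    · exact ⟨_, Or.inl rfl, hu⟩
    · exact ⟨_, Or.inr rfl, hw⟩
  -- The sums of the degrees over a vertex, and over an edge at a chosen preimage, equal `1`; so
  -- they are not empty.
  have hlift : ∀ e', ∃ e, φ '' M.edgeSet e = M'.edgeSet e' := by
    intro e'
    obtain ⟨v, hv⟩ : (Finset.univ.filter fun v =>
        φ (M.point v) = M'.point (M'.src e')).Nonempty := by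
      refine Finset.nonempty_of_sum_ne_zero (f := degV) ?_
      rw [hdeg]
      exact one_ne_zero
    obtain ⟨e, he⟩ : (Finset.univ.filter fun e =>
        M.Incident e v ∧ φ '' M.edgeSet e = M'.edgeSet e').Nonempty := by
      refine Finset.nonempty_of_sum_ne_zero (f := degE) ?_
      rw [H.balanced v _ e' (Finset.mem_filter.1 hv).2 (Or.inl rfl), hV]
      exact one_ne_zero
    exact ⟨e, (Finset.mem_filter.1 he).2.2⟩
  have hbij : Function.Bijective φ := by
    constructor
    · intro x y hxy
      obtain ⟨e₁, hx⟩ := M.exists_mem_edgeSet x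
      obtain ⟨e₂, hy⟩ := M.exists_mem_edgeSet y
      obtain ⟨e₁', he₁⟩ := H.map_edge e₁
      obtain ⟨e₂', he₂⟩ := H.map_edge e₂
      have hx' : φ x ∈ M'.edgeSet e₁' := he₁ ▸ mem_image_of_mem _ hx
      have hy' : φ x ∈ M'.edgeSet e₂' := hxy ▸ he₂ ▸ mem_image_of_mem _ hy
      -- Over a vertex, `x` and `y` both coincide with its unique preimage. Over an interior point,
      -- their edges lie over the same edge and share the preimage of its source, so they are equal,
      -- and `φ` is injective on an edge.
      rcases M'.cover (φ x) with ⟨v', hv'⟩ | ⟨e', s, hs, hs'⟩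
      · rw [hv'] at hx' hy'
        obtain ⟨v, hv, hφv⟩ := hends he₁ (M'.incident_iff.2 hx')
        obtain ⟨w, hw, hφw⟩ := hends he₂ (M'.incident_iff.2 hy')
        obtain rfl := hvertex hφv hφw
        rw [hinj e₁ x hx _ (M.incident_iff.1 hv) (hv'.trans hφv.symm),
          hinj e₂ y hy _ (M.incident_iff.1 hw) (hxy.symm.trans (hv'.trans hφw.symm))]
      · have heq : ∀ e'', φ x ∈ M'.edgeSet e'' → e'' = e' := by
          rintro e'' ⟨t, ht, h⟩
          rcases M'.eq_or_endpoints_of_edge_eq ht hs.2.le (h.trans hs') with h | ⟨-, h | h⟩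
          · exact h.1
          · exact absurd h hs.1.ne'
          · exact absurd h hs.2.ne
        obtain rfl := heq _ hx'
        obtain rfl := heq _ hy'
        obtain ⟨v, hv, hφv⟩ := hends he₁ (Or.inl rfl)
        obtain ⟨w, hw, hφw⟩ := hends he₂ (Or.inl rfl)
        obtain rfl := hvertex hφv hφw
        obtain rfl := hedge hv hw he₁ he₂
        exact hinj e₁ x hx y hy hxy
    · intro y
      obtain ⟨e', hy⟩ := M'.exists_mem_edgeSet y
      obtain ⟨e, he⟩ := hlift e'
      rw [← he] at hy
      obtain ⟨x, -, rfl⟩ := hy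
      exact ⟨x, rfl⟩
  refine ⟨hbij, fun x y => le_antisymm ?_ ?_⟩
  · exact M.dist_map_le_of_edge (fun e s t hs ht =>
      (hdist e _ ⟨s, hs, rfl⟩ _ ⟨t, ht, rfl⟩).le.trans (M.dist_edge_le hs ht)) x y
  · obtain ⟨ψ, hψ, -⟩ := Function.bijective_iff_has_inverse.1 hbij
    have := M'.dist_map_le_of_edge (Γ' := M) (φ := ψ) (fun e' s t hs ht => by
      obtain ⟨e, he⟩ := hlift e'
      obtain ⟨x, hx, hxs⟩ : M'.edge e' s ∈ φ '' M.edgeSet e := he ▸ ⟨s, hs, rfl⟩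
      obtain ⟨y, hy, hyt⟩ : M'.edge e' t ∈ φ '' M.edgeSet e := he ▸ ⟨t, ht, rfl⟩
      rw [← hxs, ← hyt, hψ x, hψ y, ← hdist e x hx y hy, hxs, hyt]
      exact M'.dist_edge_le hs ht) (φ x) (φ y)
    rwa [hψ x, hψ y] at this

theorem IsAutomorphism.exists_isIsometry {φ : X → X} (h : Γ.IsAutomorphism φ) :
    ∃ σ : Equiv.Perm X, Γ.IsIsometry σ ∧ (σ : X → X) = φ := by
  obtain ⟨hc, ⟨hX, -⟩ | ⟨hX, M, M', degE, degV, hM, hM', H, hdeg⟩⟩ := h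
  · exact ⟨1, IsIsometry.one, funext fun x => Subsingleton.elim _ _⟩
  · have : Nontrivial X := not_subsingleton_iff_nontrivial.1 fun h => hX ⟨h, h⟩
    obtain ⟨hbij, hdist⟩ := H.bijective_and_dist_map hdeg
    refine ⟨Equiv.ofBijective φ hbij, ⟨hc, fun x y => ?_⟩, rfl⟩
    exact (hM' _ _).symm.trans ((hdist x y).trans (hM x y))

end TropicalCurve

end

/-- The automorphisms of a tropical curve (its finite harmonic morphisms of degree one to itself) are
bijective and form a group under composition, which is isomorphic to the group of the automorphisms
of `Rat(Γ)` as an algebra over the tropical semifield. -/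
theorem corollary2 {X : Type*} [TopologicalSpace X] [T2Space X] (Γ : TropicalCurve X) :
    ∃ A : Subgroup (Equiv.Perm X),
      (∀ φ : X → X, Γ.IsAutomorphism φ ↔ ∃ σ ∈ A, (σ : X → X) = φ) ∧
      Nonempty (A ≃* (Γ.RatFun ≃ₐ[TropicalSemifield] Γ.RatFun)) := by
  refine ⟨Γ.isometryGroup, fun φ => ⟨fun h => h.exists_isIsometry, ?_⟩,
    ⟨MulEquiv.ofBijective Γ.isometryGroupHom TropicalCurve.isometryGroupHom_bijective⟩⟩
  rintro ⟨σ, hσ, rfl⟩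
  exact TropicalCurve.IsIsometry.isAutomorphism hσ
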